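/- **Theorem.** Let $n\ge 0$, $[n]=\{1,\dots,n\}$, and let $\mathcal B=([n],\mathcal E)$ be a chordal building set, that is, $\mathcal E$ is a set of nonempty subsets of $[n]$ (hyperedges) such that (i) $\{v\}\in\mathcal E$ for all $v\in[n]$; (ii) $A\cup B\in\mathcal E$ for all $A,B\in\mathcal E$ with $A\cap B\ne\emptyset$; (iii) for every $A=\{i_1<\dots<i_r\}\in\mathcal E$ and every $s\in[r]$ we have $\{i_1,\dots,i_s\}\in\mathcal E$. *Acyclic orientations and flips.* An orientation of $\mathcal B$ is a map $h:\mathcal E\to[n]$ with $h(A)\in A$ for all $A\in\mathcal E$. It is acyclic if the digraph with an arc $i\to j$ whenever $i\ne j$ and there is $A\in\mathcal E$ with $i,j\in A$ and $h(A)=j$ is acyclic; then $P_h$ denotes the poset on $[n]$ that is the transitive closure of this digraph ($i\prec j$ for an arc $i\to j$). Let $\mathrm{AO}_{\mathcal B}$ be the set of acyclic orientations. The flip graph on $\mathrm{AO}_{\mathcal B}$ joins two distinct acyclic orientations $h,h'$ if there are $i\neq j$ such that $h'(A)=i$ for all $A\in\mathcal E$ with $h(A)=j$ and $i\in A$, and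 $h'(A)=h(A)$ for all other $A\in\mathcal E$. *Encoding by permutations.* For $h\in\mathrm{AO}_{\mathcal B}$ define a permutation $\pi_h$ of $[n]$ recursively: for $n=0$ it is the empty permutation. For $n\ge1$, let $h_{n-1}$ be the restriction of $h$ to the hyperedges contained in $[n-1]$; $\pi_h$ is obtained by inserting $n$ into $\pi_{h_{n-1}}$, namely at the end if $n$ is maximal in $P_h$, otherwise at the beginning if $n$ is minimal in $P_h$, and otherwise directly before the unique vertex that covers $n$ in $P_h$. Let $\Pi_{\mathcal B}=\{\pi_h\mid h\in\mathrm{AO}_{\mathcal B}\}$. *Algorithm J.* A right (left) jump of the value $a$ by $d\ge1$ steps in a permutation moves $a$ to the right (left) across the $d$ entries next to it, all of which must be smaller than $a$. A jump is minimal with respect to a set $L$ of permutations of $[n]$ if every jump of the same value in the same direction by fewer steps creates a permutation not in $L$. Algorithm J with input $L$ first visits the identity permutation, and then repeatedly generates an unvisited permutation from $L$ by performing, in the most recently visited permutation, a minimal jump of the largest possible value, and visits it; it terminates if there is no such jump or if the direction of the jump is ambiguous. *Nestohedron.* Let $Z(\mathcal B)=\sum_{A\in\mathcal E}\operatorname{conv}\{e_i\mid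 i\in A\}\subset\mathbb R^n$ (Minkowski sum), and let its skeleton be the graph formed by its vertices and edges. Then Algorithm J with input $\Pi_{\mathcal B}$ generates a sequence of permutations $\pi_{h_1},\pi_{h_2},\dots$ with $h_1,h_2,\dots\in\mathrm{AO}_{\mathcal B}$ such that $h_1,h_2,\dots$ is a Hamilton path in the flip graph on $\mathrm{AO}_{\mathcal B}$, or, equivalently, on the skeleton of the chordal nestohedron $Z(\mathcal B)$. Here the equivalence is given by the map that sends $h$ to its in-degree sequence $\big(|\{A\in\mathcal E\mid h(A)=i\}|\big)_{i\in[n]}$, which is a graph isomorphism from the flip graph onto the skeleton of $Z(\mathcal B)$. -/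

import Mathlib

open scoped Pointwise

namespace HypergraphGray

/-! A hypergraph with vertex set `[n] = {1, …, n}` is given by `n` and its finite set `E` of
hyperedges, each of which is a finite set of natural numbers contained in `Finset.Icc 1 n`. -/

/-- `([n], E)` is a building set: the hyperedges are nonempty subsets of `[n]`, all singletons are
hyperedges, and the union of two intersecting hyperedges is a hyperedge. -/
structure IsBuildingSet (n : ℕ) (E : Finset (Finset ℕ)) : Prop where
  subset : ∀ A ∈ E, A ⊆ Finset.Icc 1 n
  nonempty : ∀ A ∈ E, A.Nonempty
  singleton_mem : ∀ v ∈ Finset.Icc 1 n, {v} ∈ E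
  union_mem : ∀ A ∈ E, ∀ B ∈ E, (A ∩ B).Nonempty → A ∪ B ∈ E

/-- A chordal building set: with `A = {i₁ < ⋯ < iᵣ}`, every initial part `{i₁ < ⋯ < iₛ}`,
`1 ≤ s ≤ r`, is a hyperedge as well (here `k = iₛ`). -/
structure IsChordalBuildingSet (n : ℕ) (E : Finset (Finset ℕ)) : Prop
    extends IsBuildingSet n E where
  initial_mem : ∀ A ∈ E, ∀ k ∈ A, A.filter (fun x => x ≤ k) ∈ E

/-! ### Acyclic orientations and flips -/

/-- An orientation assigns to every hyperedge one of its vertices, the head. -/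
@[ext]
structure HyperOrientation (E : Finset (Finset ℕ)) where
  head : {A : Finset ℕ // A ∈ E} → ℕ
  head_mem : ∀ A, head A ∈ A.1

namespace HyperOrientation

variable {E : Finset (Finset ℕ)}

/-- The arcs `i → j` of the digraph of an orientation. -/
def Arc (h : HyperOrientation E) (i j : ℕ) : Prop :=
  i ≠ j ∧ ∃ A : {A : Finset ℕ // A ∈ E}, i ∈ A.1 ∧ j ∈ A.1 ∧ h.head A = j

/-- `i ≺ j`: the transitive closure of the arc relation. For acyclic `h` this is the strict order
of the poset of `h`. -/
def Below (h : HyperOrientation E) (i j : ℕ) : Prop := Relation.TransGen h.Arc i j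

/-- The digraph of `h` has no directed cycle. -/
def IsAcyclic (h : HyperOrientation E) : Prop := ∀ i, ¬ h.Below i i

/-- `i` is covered by `j` in the poset of `h`. -/
def CoveredBy (h : HyperOrientation E) (i j : ℕ) : Prop :=
  h.Below i j ∧ ∀ k, ¬ (h.Below i k ∧ h.Below k j)

/-- `v` is a maximal element of the poset of `h`. -/
def IsMaxVertex (h : HyperOrientation E) (v : ℕ) : Prop := ∀ j, ¬ h.Below v j

/-- `v` is a minimal element of the poset of `h`. -/
def IsMinVertex (h : HyperOrientation E) (v : ℕ) : Prop := ∀ j, ¬ h.Below j v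

/-- `h'` arises from `h` by flipping the pair `(i, j)`: all hyperedges that contain `i` and have
head `j` get the head `i`, and `h'` is distinct from `h`. -/
def PairFlip (h h' : HyperOrientation E) (i j : ℕ) : Prop :=
  i ≠ j ∧ h' ≠ h ∧ ∀ A, h'.head A = if h.head A = j ∧ i ∈ A.1 then i else h.head A

end HyperOrientation

/-- The acyclic orientations of the hypergraph with hyperedges `E`. -/
abbrev AO (E : Finset (Finset ℕ)) : Type := {h : HyperOrientation E // h.IsAcyclic}

noncomputable instance (E : Finset (Finset ℕ)) : DecidableEq (AO E) := Classical.decEq _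

/-- The flip graph: two acyclic orientations are adjacent iff they differ in a pair flip. -/
def flipGraph (E : Finset (Finset ℕ)) : SimpleGraph (AO E) :=
  SimpleGraph.fromRel fun h h' => ∃ i j, h.1.PairFlip h'.1 i j

/-! ### The permutation of an acyclic orientation

A permutation `a₁ ⋯ aₙ` of `[n]` is the list `[a₁, …, aₙ]`. -/

/-- The hyperedges of the subhypergraph induced by `[m]`. -/
def inducedEdges (E : Finset (Finset ℕ)) (m : ℕ) : Finset (Finset ℕ) :=
  E.filter fun A => A ⊆ Finset.Icc 1 m

/-- The restriction of an orientation to the subhypergraph induced by `[m]`. -/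
def HyperOrientation.restrict {E : Finset (Finset ℕ)} (h : HyperOrientation E) (m : ℕ) :
    HyperOrientation (inducedEdges E m) where
  head A := h.head ⟨A.1, (Finset.mem_filter.mp A.2).1⟩
  head_mem A := h.head_mem ⟨A.1, (Finset.mem_filter.mp A.2).1⟩

open Classical in
/-- The permutation `π_h` of an orientation `h` of a hypergraph on `[n]`. The largest vertex `n` is
inserted into the permutation of the restriction of `h` to `[n - 1]`: at the end if `n` is maximal,
otherwise at the beginning if `n` is minimal, and otherwise directly before the unique vertex that
covers `n`. (The value is `[]`, which for `n ≥ 1` is no permutation of `[n]`, in case that there is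
no such unique vertex.) -/
noncomputable def perm : (n : ℕ) → {E : Finset (Finset ℕ)} → HyperOrientation E → List ℕ
  | 0, _, _ => []
  | n + 1, _, h =>
    if h.IsMaxVertex (n + 1) then perm n (h.restrict n) ++ [n + 1]
    else if h.IsMinVertex (n + 1) then (n + 1) :: perm n (h.restrict n)
    else if hu : ∃! v, h.CoveredBy (n + 1) v then
      (perm n (h.restrict n)).insertIdx ((perm n (h.restrict n)).idxOf hu.choose) (n + 1)
    else []

/-- The set `Π` of the permutations of all acyclic orientations of `([n], E)`. -/
def permLanguage (n : ℕ) (E : Finset (Finset ℕ)) : Set (List ℕ) :=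
  {π | ∃ h : AO E, π = perm n h.1}

/-! ### Jumps and Algorithm J -/

/-- The direction of a jump. -/
inductive Dir
  | left
  | right

/-- `σ` arises from `π` by a jump of the value `a` by `d` steps in the given direction: `a` moves
across `d ≥ 1` neighbouring entries, all of which are smaller than `a`. -/
def Jump : Dir → ℕ → ℕ → List ℕ → List ℕ → Prop
  | .right, a, d, π, σ => ∃ pre mid post : List ℕ,
      π = pre ++ [a] ++ mid ++ post ∧ σ = pre ++ mid ++ [a] ++ post ∧
      mid.length = d ∧ 0 < d ∧ ∀ x ∈ mid, x < a
  | .left, a, d, π, σ => ∃ pre mid post : List ℕ,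
      π = pre ++ mid ++ [a] ++ post ∧ σ = pre ++ [a] ++ mid ++ post ∧
      mid.length = d ∧ 0 < d ∧ ∀ x ∈ mid, x < a

/-- A jump is minimal with respect to `L` if every jump of the same value in the same direction by
fewer steps creates a permutation that is not in `L`. -/
def MinimalJump (L : Set (List ℕ)) (t : Dir) (a d : ℕ) (π σ : List ℕ) : Prop :=
  Jump t a d π σ ∧ ∀ d' < d, ∀ τ, Jump t a d' π τ → τ ∉ L

/-- `σ` is a permutation in `L` not visited so far, and it arises from `π` by a minimal jump of the
value `a` in direction `t`. -/
def Candidate (L : Set (List ℕ)) (visited : List (List ℕ)) (π : List ℕ) (t : Dir) (a : ℕ)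
    (σ : List ℕ) : Prop :=
  σ ∈ L ∧ σ ∉ visited ∧ ∃ d, MinimalJump L t a d π σ

/-- One execution of the jump step, at the most recently visited permutation `π`: the next
permutation `σ` is obtained by a minimal jump of the largest possible value, and the direction of
this jump is not ambiguous. -/
def JStep (L : Set (List ℕ)) (visited : List (List ℕ)) (π σ : List ℕ) : Prop :=
  ∃ t a, Candidate L visited π t a σ ∧
    ∀ t' a' τ, Candidate L visited π t' a' τ → a' < a ∨ (a' = a ∧ t' = t)

/-- The lists of permutations, in the order of the visits, that are visited by Algorithm J with
input `L` and initial permutation `π₀` after some number of jump steps. -/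
inductive JHistory (L : Set (List ℕ)) (π₀ : List ℕ) : List (List ℕ) → Prop
  | init : JHistory L π₀ [π₀]
  | step {l : List (List ℕ)} {π σ : List ℕ} : JHistory L π₀ (l ++ [π]) →
      JStep L (l ++ [π]) π σ → JHistory L π₀ (l ++ [π] ++ [σ])

/-- Algorithm J with input `L` and initial permutation `π₀` visits exactly the permutations in the
list `out`, in this order, and then terminates, since no further jump step is possible. -/
def AlgorithmJ (L : Set (List ℕ)) (π₀ : List ℕ) (out : List (List ℕ)) : Prop :=
  JHistory L π₀ out ∧ ∀ π ∈ out.getLast?, ∀ σ, ¬ JStep L out π σ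

/-- The identity permutation `1 2 ⋯ n`. -/
def idPerm (n : ℕ) : List ℕ := List.range' 1 n

/-! ### Hypergraphic polytopes -/

/-- The space `ℝⁿ`, with coordinates indexed by `[n]`. -/
abbrev Space (n : ℕ) : Type := {i : ℕ // i ∈ Finset.Icc 1 n} → ℝ

/-- The standard simplex of `S ⊆ [n]`. -/
def simplex (n : ℕ) (S : Finset ℕ) : Set (Space n) :=
  convexHull ℝ {x | ∃ i : {i : ℕ // i ∈ Finset.Icc 1 n}, i.1 ∈ S ∧ x = Pi.single i 1}

/-- The hypergraphic polytope of `([n], E)`: the Minkowski sum of the simplices of the hyperedges.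
For a building set this is its nestohedron. -/
def hypergraphicPolytope (n : ℕ) (E : Finset (Finset ℕ)) : Set (Space n) :=
  ∑ A ∈ E, simplex n A

/-- The skeleton of a polytope `P`: the graph whose vertices are the vertices of `P`, where two of
them are adjacent iff the segment between them is a face of `P`. -/
def skeleton {n : ℕ} (P : Set (Space n)) : SimpleGraph {x : Space n // x ∈ P.exposedPoints ℝ} where
  Adj x y := x ≠ y ∧ IsExposed ℝ P (segment ℝ x.1 y.1)
  symm := ⟨fun x y hxy => ⟨hxy.1.symm, by rw [segment_symm]; exact hxy.2⟩⟩
  loopless := ⟨fun _ hx => hx.1 rfl⟩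

/-- The in-degree sequence of an orientation. -/
def inDegreeSeq (n : ℕ) {E : Finset (Finset ℕ)} (h : HyperOrientation E) : Space n :=
  fun i => ((Finset.univ.filter fun A : {A : Finset ℕ // A ∈ E} => h.head A = i.1).card : ℝ)

noncomputable instance {n : ℕ} (P : Set (Space n)) :
    DecidableEq {x : Space n // x ∈ P.exposedPoints ℝ} := Classical.decEq _

end HypergraphGray

/-! Call a permutation compatible with an orientation (`Respects`) if every head is the last vertex
of its hyperedge. Each permutation of $[n]$ is compatible with exactly one orientation, and that
orientation is acyclic. As $\pi_h$ is compatible with $h$ (`IsChordalBuildingSet.perm_spec`), it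
determines $h$. Chordality acts through the largest vertex $n$: removing it from a hyperedge with a
further vertex leaves a hyperedge, whose head is unchanged unless it was $n$.

Let $\pi$ be the permutation of an acyclic orientation on $[n-1]$. While $n$ slides through $\pi$,
the compatible orientation changes by at most one flip per crossed entry, and each orientation owns
an interval of positions. One position of each interval belongs to $\Pi_{\mathcal B}$, so
consecutive members of $\Pi_{\mathcal B}$ over $\pi$ differ by a flip
(`IsChordalBuildingSet.consecutiveRelated`). If $n$ shares a hyperedge with another vertex, both
ends of $\pi$ are among these positions, and flips on $[n-1]$ lift with $n$ at either end; otherwise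
$n$ always stands last.

Algorithm J therefore sweeps $n$ across $\pi$, takes one step of the run for $[n-1]$ while $n$ rests
at an end, sweeps back, and so on (`ZigzagExtension.exists_isGrayRun`). Induction on $n$ gives the
Hamilton path, and determinism of the algorithm makes its output unique.

For the polytope, a linear functional is maximized by choosing in each hyperedge a vertex of largest
weight. Weights increasing along all arcs expose the vertex of $h$; weights with a single tie at a
flipped pair, which is a cover of the poset, expose an edge. Conversely, changing one head inside an
exposed segment moves parallel to the segment, so all changes between its ends concern one pair
$(i,j)$. -/

namespace HypergraphGray

open HyperOrientation

/-! ### Inserting a value into a list -/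

/-- The list that arises from `π` by inserting `a` at position `k`. -/
def insertAt (a : ℕ) (π : List ℕ) (k : ℕ) : List ℕ := π.take k ++ a :: π.drop k

theorem insertAt_zero (a : ℕ) (π : List ℕ) : insertAt a π 0 = a :: π := rfl

theorem insertAt_length (a : ℕ) (π : List ℕ) : insertAt a π π.length = π ++ [a] := by
  simp [insertAt]

theorem insertAt_append (a : ℕ) (l r : List ℕ) : insertAt a (l ++ r) l.length = l ++ a :: r := by
  simp [insertAt]

theorem insertIdx_eq_insertAt (a : ℕ) (π : List ℕ) (k : ℕ) (hk : k ≤ π.length) :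
    π.insertIdx k a = insertAt a π k := by
  induction π generalizing k with
  | nil => obtain rfl : k = 0 := by simpa using hk
           simp [insertAt]
  | cons x π ih =>
    cases k with
    | zero => simp [insertAt]
    | succ k =>
      have := ih k (by simpa using hk)
      simp only [insertAt] at this
      simp [insertAt, this]

theorem mem_insertAt {a x k : ℕ} {π : List ℕ} : x ∈ insertAt a π k ↔ x = a ∨ x ∈ π := by
  conv_rhs => rw [← List.take_append_drop k π]
  simp only [insertAt, List.mem_append, List.mem_cons]
  tauto

theorem perm_insertAt (a : ℕ) (π : List ℕ) (k : ℕ) : (insertAt a π k).Perm (a :: π) := by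
  have h : (insertAt a π k).Perm (a :: (π.take k ++ π.drop k)) := List.perm_middle
  rwa [List.take_append_drop] at h

theorem append_cons_inj_of_notMem {a : ℕ} {l₁ l₂ r₁ r₂ : List ℕ} (h₁ : a ∉ l₁) (h₂ : a ∉ l₂)
    (h : l₁ ++ a :: r₁ = l₂ ++ a :: r₂) : l₁ = l₂ ∧ r₁ = r₂ := by
  induction l₁ generalizing l₂ with
  | nil =>
    cases l₂ with
    | nil => simpa using h
    | cons y l₂ => simp at h; simp [h.1] at h₂
  | cons x l₁ ih =>
    cases l₂ with
    | nil => simp at h; simp [h.1] at h₁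
    | cons y l₂ =>
      simp only [List.cons_append, List.cons.injEq] at h
      obtain ⟨rfl, h⟩ := h
      simp only [List.mem_cons, not_or] at h₁ h₂
      obtain ⟨rfl, rfl⟩ := ih h₁.2 h₂.2 h
      exact ⟨rfl, rfl⟩

theorem insertAt_inj {a j k : ℕ} {π σ : List ℕ} (hπ : a ∉ π) (hσ : a ∉ σ) (hj : j ≤ π.length)
    (hk : k ≤ σ.length) (h : insertAt a π j = insertAt a σ k) : π = σ ∧ j = k := by
  obtain ⟨h₁, h₂⟩ := append_cons_inj_of_notMem (fun h => hπ (List.mem_of_mem_take h))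
    (fun h => hσ (List.mem_of_mem_take h)) h
  constructor
  · rw [← List.take_append_drop j π, h₁, h₂, List.take_append_drop]
  · simpa [hj, hk] using congrArg List.length h₁

/-! ### Jumps -/

theorem Jump.value_mem {t : Dir} {a d : ℕ} {π σ : List ℕ} (h : Jump t a d π σ) : a ∈ π := by
  cases t <;> obtain ⟨pre, mid, post, rfl, -⟩ := h <;> simp

/-- As `a` exceeds all entries of `π`, the size condition on crossed entries is void, and as `a`
occurs only once, the decomposition in a jump is forced. Jumps of the largest value are thus mere
changes of position. -/
theorem jump_right_insertAt {a d k : ℕ} {π σ : List ℕ} (hlt : ∀ x ∈ π, x < a)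
    (hk : k ≤ π.length) :
    Jump .right a d (insertAt a π k) σ ↔
      0 < d ∧ k + d ≤ π.length ∧ σ = insertAt a π (k + d) := by
  have ha : a ∉ π := fun h => lt_irrefl _ (hlt a h)
  constructor
  · rintro ⟨pre, mid, post, h₁, rfl, rfl, hd, hm⟩
    have hpre : a ∉ pre := by
      intro hp
      have hc := congrArg (List.count a) h₁
      have := (perm_insertAt a π k).count_eq a
      rw [hc] at this
      have h0 : List.count a pre ≠ 0 := by
        simpa [List.count_eq_zero] using hp
      have h1 : List.count a π = 0 := List.count_eq_zero.mpr ha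
      simp [h1] at this
      omega
    have h₂ : π.take k = pre ∧ π.drop k = mid ++ post :=
      append_cons_inj_of_notMem (fun h => ha (List.mem_of_mem_take h)) hpre
        (by simpa [insertAt] using h₁)
    have hpi : π = pre ++ (mid ++ post) := by
      rw [← h₂.1, ← h₂.2, List.take_append_drop]
    have hl : k = pre.length := by
      rw [← h₂.1]; simp [hk]
    subst hl
    refine ⟨hd, ?_, ?_⟩
    · rw [hpi]; simp
    · rw [hpi, ← List.append_assoc, ← List.length_append, insertAt_append]; simp
  · rintro ⟨hd, hkd, rfl⟩
    refine ⟨π.take k, (π.drop k).take d, π.drop (k + d), ?_, ?_, ?_, hd, ?_⟩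
    · have : π.drop k = (π.drop k).take d ++ π.drop (k + d) := by
        rw [← List.drop_drop, List.take_append_drop]
      simp [insertAt, ← this]
    · simp [insertAt, List.take_add]
    · simp; omega
    · intro x hx
      exact hlt x (List.mem_of_mem_drop (List.mem_of_mem_take hx))

theorem jump_symm {a d : ℕ} {π σ : List ℕ} : Jump .left a d π σ ↔ Jump .right a d σ π := by
  constructor <;> rintro ⟨pre, mid, post, h₁, h₂, h⟩ <;> exact ⟨pre, mid, post, h₂, h₁, h⟩

theorem jump_right_perm {a d : ℕ} {π σ : List ℕ} (h : Jump .right a d π σ) : π.Perm σ := by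
  obtain ⟨pre, mid, post, rfl, rfl, -⟩ := h
  refine List.Perm.append_right _ ?_
  simp only [List.append_assoc]
  exact List.Perm.append_left _ List.perm_append_comm

theorem jump_perm {t : Dir} {a d : ℕ} {π σ : List ℕ} (h : Jump t a d π σ) : π.Perm σ := by
  cases t
  · exact (jump_right_perm (jump_symm.mp h)).symm
  · exact jump_right_perm h

theorem jump_left_insertAt {a d k : ℕ} {π σ : List ℕ} (hlt : ∀ x ∈ π, x < a)
    (hk : k ≤ π.length) :
    Jump .left a d (insertAt a π k) σ ↔ 0 < d ∧ d ≤ k ∧ σ = insertAt a π (k - d) := by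
  have ha : a ∉ π := fun h => lt_irrefl _ (hlt a h)
  constructor
  · rintro ⟨pre, mid, post, h₁, rfl, rfl, hd, hm⟩
    have hperm : (insertAt a π k).Perm (a :: (pre ++ mid ++ post)) := by
      have h₃ : pre ++ mid ++ [a] ++ post = (pre ++ mid) ++ a :: post := by simp
      rw [h₁, h₃]
      exact List.perm_middle
    have hpi : a ∉ pre ++ mid ++ post := by
      have := ((perm_insertAt a π k).symm.trans hperm).cons_inv
      exact fun h => ha (this.mem_iff.mpr h)
    have h₂ : π.take k = pre ++ mid ∧ π.drop k = post :=
      append_cons_inj_of_notMem (fun h => ha (List.mem_of_mem_take h))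
        (fun h => hpi (List.mem_append_left _ h)) (by simpa [insertAt] using h₁)
    have hpi : π = pre ++ mid ++ post := by
      rw [← h₂.1, ← h₂.2, List.take_append_drop]
    have hl : k = pre.length + mid.length := by
      rw [← List.length_append, ← h₂.1]; simp [hk]
    subst hl
    refine ⟨hd, by omega, ?_⟩
    rw [hpi, Nat.add_sub_cancel, List.append_assoc pre mid, insertAt_append]; simp
  · rintro ⟨hd, hkd, rfl⟩
    rw [jump_symm, jump_right_insertAt hlt (by omega)]
    exact ⟨hd, by omega, by congr 1; omega⟩

theorem exists_insertAt_of_jump {t : Dir} {a d k : ℕ} {π σ : List ℕ} (hlt : ∀ x ∈ π, x < a)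
    (hk : k ≤ π.length) (h : Jump t a d (insertAt a π k) σ) :
    ∃ k' ≤ π.length, σ = insertAt a π k' := by
  cases t
  · obtain ⟨-, h, rfl⟩ := (jump_left_insertAt hlt hk).mp h
    exact ⟨_, by omega, rfl⟩
  · obtain ⟨-, hd, rfl⟩ := (jump_right_insertAt hlt hk).mp h
    exact ⟨_, hd, rfl⟩

theorem jump_right_cons {a b d : ℕ} {π σ : List ℕ} (hb : b < a) (h : Jump .right b d (a :: π) σ) :
    ∃ τ, σ = a :: τ ∧ Jump .right b d π τ := by
  obtain ⟨pre, mid, post, h₁, rfl, h⟩ := h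
  cases pre with
  | nil => simp at h₁; omega
  | cons x pre =>
    simp only [List.cons_append, List.cons.injEq] at h₁
    obtain ⟨rfl, rfl⟩ := h₁
    exact ⟨_, rfl, pre, mid, post, rfl, rfl, h⟩

theorem jump_left_cons {a b d : ℕ} {π σ : List ℕ} (hb : b < a) (h : Jump .left b d (a :: π) σ) :
    ∃ τ, σ = a :: τ ∧ Jump .left b d π τ := by
  obtain ⟨pre, mid, post, h₁, rfl, h₂, h₃, h₄⟩ := h
  cases pre with
  | nil =>
    cases mid with
    | nil => simp at h₂; omega
    | cons y mid =>
      simp only [List.nil_append, List.cons_append, List.cons.injEq] at h₁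
      have := h₄ y (by simp)
      omega
  | cons x pre =>
    simp only [List.cons_append, List.cons.injEq] at h₁
    obtain ⟨rfl, rfl⟩ := h₁
    exact ⟨_, rfl, pre, mid, post, rfl, rfl, h₂, h₃, h₄⟩

/-- A smaller value cannot cross `a`, so an `a` at the front takes no part in its jumps. -/
theorem jump_cons {t : Dir} {a b d : ℕ} {π σ : List ℕ} (hb : b < a) :
    Jump t b d (a :: π) σ ↔ ∃ τ, σ = a :: τ ∧ Jump t b d π τ := by
  constructor
  · cases t
    · exact jump_left_cons hb
    · exact jump_right_cons hb
  · rintro ⟨τ, rfl, h⟩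
    cases t <;> obtain ⟨pre, mid, post, rfl, rfl, h⟩ := h <;>
      exact ⟨a :: pre, mid, post, rfl, rfl, h⟩

/-- The opposite direction. -/
def Dir.flip : Dir → Dir
  | .left => .right
  | .right => .left

theorem jump_reverse {t : Dir} {a d : ℕ} {π σ : List ℕ} (h : Jump t a d π σ) :
    Jump t.flip a d π.reverse σ.reverse := by
  cases t <;> obtain ⟨pre, mid, post, rfl, rfl, h₁, h₂, h₃⟩ := h <;>
    exact ⟨post.reverse, mid.reverse, pre.reverse, by simp, by simp, by simpa using h₁, h₂,
      fun x hx => h₃ x (by simpa using hx)⟩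

theorem jump_concat {t : Dir} {a b d : ℕ} {π σ : List ℕ} (hb : b < a) :
    Jump t b d (π ++ [a]) σ ↔ ∃ τ, σ = τ ++ [a] ∧ Jump t b d π τ := by
  constructor
  · intro h
    have := jump_reverse h
    rw [List.reverse_append, List.reverse_singleton, List.singleton_append, jump_cons hb] at this
    obtain ⟨τ, h₁, h₂⟩ := this
    refine ⟨τ.reverse, by rw [← List.reverse_reverse σ, h₁]; simp, ?_⟩
    have := jump_reverse h₂
    rw [List.reverse_reverse] at this
    cases t <;> exact this
  · rintro ⟨τ, rfl, h⟩
    cases t <;> obtain ⟨pre, mid, post, rfl, rfl, h⟩ := h <;>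
      exact ⟨pre, mid, post ++ [a], by simp, by simp, h⟩

/-! ### Determinism of Algorithm J -/

theorem jump_right_unique {a d : ℕ} {π σ τ : List ℕ} (hn : π.Nodup) (h : Jump .right a d π σ)
    (h' : Jump .right a d π τ) : σ = τ := by
  obtain ⟨pre, mid, post, rfl, rfl, h₂, -⟩ := h
  obtain ⟨pre', mid', post', h₁, rfl, h₂', -⟩ := h'
  have ha : a ∉ pre := fun h => by
    simp [List.nodup_append] at hn
    exact (hn.2.2 a h).1 rfl
  have hn' := hn
  rw [h₁] at hn'
  have ha' : a ∉ pre' := fun h => by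
    simp [List.nodup_append] at hn'
    exact (hn'.2.2 a h).1 rfl
  simp only [List.append_assoc, List.singleton_append] at h₁
  obtain ⟨rfl, h⟩ := append_cons_inj_of_notMem ha ha' h₁
  obtain ⟨rfl, rfl⟩ := List.append_inj h (by omega)
  rfl

theorem jump_unique {t : Dir} {a d : ℕ} {π σ τ : List ℕ} (hn : π.Nodup) (h : Jump t a d π σ)
    (h' : Jump t a d π τ) : σ = τ := by
  cases t
  · exact List.reverse_injective (jump_right_unique (by simpa using hn) (jump_reverse h)
      (jump_reverse h'))
  · exact jump_right_unique hn h h'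

/-- Maximality of the value, applied both ways, equates the values; unambiguity equates the
directions; minimality equates the numbers of steps. -/
theorem jstep_unique {L : Set (List ℕ)} {V : List (List ℕ)} {π σ τ : List ℕ} (hn : π.Nodup)
    (h : JStep L V π σ) (h' : JStep L V π τ) : σ = τ := by
  obtain ⟨t, a, hc, hm⟩ := h
  obtain ⟨t', a', hc', hm'⟩ := h'
  have h₁ := hm _ _ _ hc'
  have h₂ := hm' _ _ _ hc
  obtain rfl : a' = a := by omega
  obtain rfl : t' = t := by simpa using h₁
  obtain ⟨hL, -, d, hj, hd⟩ := hc
  obtain ⟨hL', -, d', hj', hd'⟩ := hc'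
  obtain rfl : d = d' := by
    rcases lt_trichotomy d d' with h | h | h
    · exact absurd hL (hd' d h _ hj)
    · exact h
    · exact absurd hL' (hd d' h _ hj')
  exact jump_unique hn hj hj'

theorem JHistory.nodup_of_mem {L : Set (List ℕ)} {π₀ : List ℕ} {l : List (List ℕ)}
    (hn : π₀.Nodup) (h : JHistory L π₀ l) : ∀ π ∈ l, π.Nodup := by
  induction h with
  | init => simpa using hn
  | step h hs ih =>
    intro π hπ
    rcases List.mem_append.mp hπ with hπ | hπ
    · exact ih π hπ
    · obtain rfl : π = _ := by simpa using hπ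
      obtain ⟨t, a, ⟨-, -, d, hj, -⟩, -⟩ := hs
      exact (jump_perm hj).nodup_iff.mp (ih _ (by simp))

theorem JHistory.ne_nil {L : Set (List ℕ)} {π₀ : List ℕ} {l : List (List ℕ)}
    (h : JHistory L π₀ l) : l ≠ [] := by
  cases h <;> simp

theorem JHistory.eq_of_length_eq {L : Set (List ℕ)} {π₀ : List ℕ} {l l' : List (List ℕ)}
    (hn : π₀.Nodup) (h : JHistory L π₀ l) (h' : JHistory L π₀ l') (hl : l.length = l'.length) :
    l = l' := by
  induction h generalizing l' with
  | init =>
    cases h' with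
    | init => rfl
    | step h hs => simp at hl
  | step h hs ih =>
    cases h' with
    | init => simp at hl
    | step h' hs' =>
      have := ih h' (by simpa using hl)
      obtain ⟨rfl, h₂⟩ := List.append_inj' this rfl
      obtain rfl : _ = _ := by simpa using h₂
      rw [jstep_unique (h.nodup_of_mem hn _ (by simp)) hs hs']

theorem JHistory.take {L : Set (List ℕ)} {π₀ : List ℕ} {l : List (List ℕ)}
    (h : JHistory L π₀ l) (k : ℕ) : JHistory L π₀ (l.take (k + 1)) := by
  induction h with
  | init => simpa using JHistory.init
  | @step l π σ h hs ih =>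
    by_cases hk : k + 1 ≤ (l ++ [π]).length
    · rwa [List.take_append_of_le_length hk]
    · rw [List.take_of_length_le (by simp at hk ⊢; omega)]
      exact .step h hs

/-- A longer history, cut to one entry more than `l`, would extend `l` by a further jump step,
against termination. -/
theorem AlgorithmJ.length_le {L : Set (List ℕ)} {π₀ : List ℕ} {l l' : List (List ℕ)}
    (hn : π₀.Nodup) (h : AlgorithmJ L π₀ l) (h' : JHistory L π₀ l') : l'.length ≤ l.length := by
  by_contra! hlt
  obtain ⟨h, hterm⟩ := h
  have ht := h'.take l.length
  have hlen : (l'.take (l.length + 1)).length = l.length + 1 := List.length_take_of_le hlt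
  generalize l'.take (l.length + 1) = m at ht hlen
  cases ht with
  | init => exact absurd (by simpa using hlen) h.ne_nil
  | step hm hs =>
    obtain rfl := h.eq_of_length_eq hn hm (by simp at hlen ⊢; omega)
    exact hterm _ (by simp) _ hs

/-- Algorithm J is deterministic. -/
theorem AlgorithmJ.iff_eq {L : Set (List ℕ)} {π₀ : List ℕ} {l : List (List ℕ)}
    (hn : π₀.Nodup) (h : AlgorithmJ L π₀ l) (l' : List (List ℕ)) :
    AlgorithmJ L π₀ l' ↔ l' = l := by
  constructor
  · intro h'
    exact h'.1.eq_of_length_eq hn h.1 (le_antisymm (h.length_le hn h'.1) (h'.length_le hn h.1))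
  · rintro rfl
    exact h

/-! ### Runs of Algorithm J along a relation -/

/-- A jump step of Algorithm J between permutations related by `G`. -/
def GrayStep (L : Set (List ℕ)) (G : List ℕ → List ℕ → Prop) (V : List (List ℕ))
    (π σ : List ℕ) : Prop := JStep L V π σ ∧ G π σ

/-- The lists visited by iterating a step relation that may depend on the visited permutations. -/
inductive RunHistory (S : List (List ℕ) → List ℕ → List ℕ → Prop) (π₀ : List ℕ) :
    List (List ℕ) → Prop
  | init : RunHistory S π₀ [π₀]
  | step {l : List (List ℕ)} {π σ : List ℕ} : RunHistory S π₀ (l ++ [π]) →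
      S (l ++ [π]) π σ → RunHistory S π₀ (l ++ [π] ++ [σ])

/-- A run of Algorithm J that visits all of `L`, terminates, and follows the relation `G`. -/
structure IsGrayRun (L : Set (List ℕ)) (G : List ℕ → List ℕ → Prop) (π₀ : List ℕ)
    (out : List (List ℕ)) : Prop where
  history : RunHistory (GrayStep L G) π₀ out
  mem_iff : ∀ π, π ∈ out ↔ π ∈ L
  terminal : ∀ π ∈ out.getLast?, ∀ σ, ¬ JStep L out π σ

section

variable {L : Set (List ℕ)} {G : List ℕ → List ℕ → Prop} {π₀ : List ℕ} {l : List (List ℕ)}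

theorem RunHistory.jHistory (h : RunHistory (GrayStep L G) π₀ l) : JHistory L π₀ l := by
  induction h with
  | init => exact .init
  | step h hs ih => exact .step ih hs.1

theorem JStep.mem {V : List (List ℕ)} {π σ : List ℕ} (h : JStep L V π σ) : σ ∈ L := by
  obtain ⟨t, a, ⟨h, -⟩, -⟩ := h
  exact h

theorem JStep.notMem {V : List (List ℕ)} {π σ : List ℕ} (h : JStep L V π σ) : σ ∉ V := by
  obtain ⟨t, a, ⟨-, h, -⟩, -⟩ := h
  exact h

theorem RunHistory.subset (h : RunHistory (GrayStep L G) π₀ l) (h₀ : π₀ ∈ L) :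
    ∀ π ∈ l, π ∈ L := by
  induction h with
  | init => simpa using h₀
  | step h hs ih =>
    intro π hπ
    rcases List.mem_append.mp hπ with hπ | hπ
    · exact ih π hπ
    · obtain rfl : π = _ := by simpa using hπ
      exact hs.1.mem

theorem RunHistory.nodup (h : RunHistory (GrayStep L G) π₀ l) : l.Nodup := by
  induction h with
  | init => simp
  | step h hs ih =>
    rw [List.nodup_append]
    refine ⟨ih, by simp, ?_⟩
    rintro π hπ σ hσ rfl
    exact hs.1.notMem (by rwa [List.mem_singleton.mp hσ] at hπ)

theorem RunHistory.isChain (h : RunHistory (GrayStep L G) π₀ l) : l.IsChain G := by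
  induction h with
  | init => simp
  | step h hs ih =>
    rw [List.isChain_append]
    exact ⟨ih, by simp, by simpa using hs.2⟩

theorem RunHistory.ne_nil {S : List (List ℕ) → List ℕ → List ℕ → Prop}
    (h : RunHistory S π₀ l) : l ≠ [] := by
  cases h <;> simp

theorem IsGrayRun.algorithmJ (h : IsGrayRun L G π₀ l) : AlgorithmJ L π₀ l :=
  ⟨h.history.jHistory, h.terminal⟩

end

/-! ### Extending a run by a new largest value -/

/-- The order in which a value that moves in the given direction visits its positions. -/
def Dir.rel : Dir → ℕ → ℕ → Prop
  | .left => fun i j => j < i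
  | .right => fun i j => i < j

section

variable {L L' : Set (List ℕ)} {G G' : List ℕ → List ℕ → Prop} {a : ℕ} {π π₀ : List ℕ}

/-- The position in a permutation of length `N` where a value starts to move. -/
def Dir.start (N : ℕ) : Dir → ℕ
  | .left => N
  | .right => 0

/-- The insertion of `a` at the end where it starts to move. -/
def Dir.insertStart (a : ℕ) : Dir → List ℕ → List ℕ
  | .left => fun π => π ++ [a]
  | .right => fun π => a :: π

theorem insertAt_start (a : ℕ) (t : Dir) (π : List ℕ) :
    insertAt a π (t.start π.length) = t.insertStart a π := by
  cases t
  · exact insertAt_length a π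
  · rfl

/-- Consecutive positions of the largest value `a` correspond to related permutations. -/
def ConsecutiveRelated (L' : Set (List ℕ)) (G' : List ℕ → List ℕ → Prop) (a : ℕ) (π : List ℕ) :
    Prop :=
  ∀ p q, p < q → q ≤ π.length → insertAt a π p ∈ L' → insertAt a π q ∈ L' →
    (∀ m, p < m → m < q → insertAt a π m ∉ L') →
    G' (insertAt a π p) (insertAt a π q) ∧ G' (insertAt a π q) (insertAt a π p)

theorem insertAt_injOn (hlt : ∀ x ∈ π, x < a) {j k : ℕ} (hj : j ≤ π.length) (hk : k ≤ π.length)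
    (h : insertAt a π j = insertAt a π k) : j = k :=
  have ha : a ∉ π := fun h => lt_irrefl _ (hlt a h)
  (insertAt_inj ha ha hj hk h).2

theorem jump_of_rel (hlt : ∀ x ∈ π, x < a) {t : Dir} {k k' : ℕ} (hk : k ≤ π.length)
    (hk' : k' ≤ π.length) (h : t.rel k k') :
    Jump t a (k - k' + (k' - k)) (insertAt a π k) (insertAt a π k') := by
  cases t
  · replace h : k' < k := h
    rw [jump_left_insertAt hlt hk]
    exact ⟨by omega, by omega, by congr 1; omega⟩
  · replace h : k < k' := h
    rw [jump_right_insertAt hlt hk]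
    exact ⟨by omega, by omega, by congr 1; omega⟩

theorem exists_rel_of_jump (hlt : ∀ x ∈ π, x < a) {t : Dir} {k d : ℕ} {σ : List ℕ}
    (hk : k ≤ π.length) (h : Jump t a d (insertAt a π k) σ) :
    ∃ k' ≤ π.length, t.rel k k' ∧ d = k - k' + (k' - k) ∧ σ = insertAt a π k' := by
  cases t
  · obtain ⟨h₁, h₂, rfl⟩ := (jump_left_insertAt hlt hk).mp h
    exact ⟨_, by omega, show k - d < k by omega, by omega, rfl⟩
  · obtain ⟨h₁, h₂, rfl⟩ := (jump_right_insertAt hlt hk).mp h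
    exact ⟨_, by omega, show k < k + d by omega, by omega, rfl⟩

/-- Here `K₁ ++ k :: k' :: K₂` lists all positions of `a` over `π` that give members of `L'`, in the
order of the sweep, and `V` contains no insertion into `π`. Jumps of the largest value have
priority, and every position behind `k` has been visited, so the direction is not ambiguous. -/
theorem jstep_insertAt (hlt : ∀ x ∈ π, x < a) {t : Dir} {K₁ K₂ : List ℕ} {k k' : ℕ}
    {V : List (List ℕ)} (hK : (K₁ ++ k :: k' :: K₂).Pairwise t.rel)
    (hmem : ∀ m, m ∈ K₁ ++ k :: k' :: K₂ ↔ m ≤ π.length ∧ insertAt a π m ∈ L')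
    (hV : ∀ m ≤ π.length, insertAt a π m ∉ V) :
    JStep L' (V ++ (K₁ ++ [k]).map (insertAt a π)) (insertAt a π k) (insertAt a π k') := by
  have hk := (hmem k).mp (by simp)
  have hk' := (hmem k').mp (by simp)
  have hsplit : ∀ m ≤ π.length, insertAt a π m ∈ L' →
      (m ∈ K₁ ∧ t.rel m k ∧ t.rel m k') ∨ m = k ∨ m = k' ∨ (t.rel k m ∧ t.rel k' m) := by
    intro m hm hmL
    have := (hmem m).mpr ⟨hm, hmL⟩
    simp only [List.pairwise_append, List.pairwise_cons, List.mem_cons] at hK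
    simp only [List.mem_append, List.mem_cons] at this
    rcases this with h | h | h | h
    · exact Or.inl ⟨h, hK.2.2 m h k (by simp), hK.2.2 m h k' (by simp)⟩
    · exact Or.inr (Or.inl h)
    · exact Or.inr (Or.inr (Or.inl h))
    · exact Or.inr (Or.inr (Or.inr ⟨hK.2.1.1 m (by simp [h]), hK.2.1.2.1 m h⟩))
  have hkk' : t.rel k k' := by
    simp only [List.pairwise_append, List.pairwise_cons, List.mem_cons] at hK
    exact hK.2.1.1 k' (by simp)
  have hk'K : k' ∉ K₁ ++ [k] := by
    intro h
    have h₁ : t.rel k' k' := by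
      have h₂ : ((K₁ ++ [k]) ++ k' :: K₂).Pairwise t.rel := by simpa using hK
      exact (List.pairwise_append.mp h₂).2.2 k' h k' (by simp)
    cases t <;> exact lt_irrefl _ h₁
  refine ⟨t, a, ⟨hk'.2, ?_, k - k' + (k' - k), jump_of_rel hlt hk.1 hk'.1 hkk', ?_⟩, ?_⟩
  · rw [List.mem_append, List.mem_map]
    rintro (h | ⟨m, hm, h⟩)
    · exact hV k' hk'.1 h
    · refine hk'K ?_
      rwa [← insertAt_injOn hlt ((hmem m).mp (by
        simp only [List.mem_append, List.mem_cons] at hm ⊢; tauto)).1 hk'.1 h]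
  -- A shorter jump would end at a position of the list strictly between the neighbours `k` and
  -- `k'`.
  · rintro d' hd' τ hj hτ
    obtain ⟨m, hm, hr, rfl, rfl⟩ := exists_rel_of_jump hlt hk.1 hj
    have := hsplit m hm hτ
    cases t <;> simp only [Dir.rel] at this hr hkk' <;> omega
  · rintro t' b τ ⟨hτ, hτV, d, hj, -⟩
    have hb := hj.value_mem
    rw [mem_insertAt] at hb
    rcases hb with rfl | hb
    · refine Or.inr ⟨rfl, ?_⟩
      by_contra htt
      obtain ⟨m, hm, hr, -, rfl⟩ := exists_rel_of_jump hlt hk.1 hj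
      -- A jump against the sweep ends at an earlier position of the list, hence at a visited
      -- permutation.
      have hmK : m ∈ K₁ := by
        have := hsplit m hm hτ
        by_contra hmK
        simp only [hmK, false_and, false_or] at this
        cases t <;> cases t' <;> simp only [Dir.rel] at this hr hkk' <;>
          first | exact htt rfl | omega
      exact hτV (List.mem_append_right _ (List.mem_map_of_mem (by simp [hmK])))
    · exact Or.inl (hlt b hb)

theorem RunHistory.block (hlt : ∀ x ∈ π, x < a) (hG : ConsecutiveRelated L' G' a π) {t : Dir}
    {K₁ K₂ : List ℕ} {k : ℕ} {V : List (List ℕ)} (hK : (K₁ ++ k :: K₂).Pairwise t.rel)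
    (hmem : ∀ m, m ∈ K₁ ++ k :: K₂ ↔ m ≤ π.length ∧ insertAt a π m ∈ L')
    (hV : ∀ m ≤ π.length, insertAt a π m ∉ V)
    (h : RunHistory (GrayStep L' G') π₀ (V ++ (K₁ ++ [k]).map (insertAt a π))) :
    RunHistory (GrayStep L' G') π₀ (V ++ (K₁ ++ k :: K₂).map (insertAt a π)) := by
  induction K₂ generalizing K₁ k with
  | nil => exact h
  | cons k' K₂ ih =>
    have hs := jstep_insertAt hlt hK hmem hV
    have hGs : G' (insertAt a π k) (insertAt a π k') := by
      have hk := (hmem k).mp (by simp)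
      have hk' := (hmem k').mp (by simp)
      have hbetween : ∀ m ≤ π.length, t.rel k m → t.rel m k' → insertAt a π m ∉ L' := by
        intro m hm h₁ h₂ hmL
        have := (hmem m).mpr ⟨hm, hmL⟩
        simp only [List.pairwise_append, List.pairwise_cons, List.mem_cons] at hK
        simp only [List.mem_append, List.mem_cons] at this
        rcases this with h | rfl | rfl | h
        · have h₃ := hK.2.2 m h k (by simp)
          cases t <;> exact lt_asymm h₁ h₃
        · cases t <;> exact lt_irrefl _ h₁
        · cases t <;> exact lt_irrefl _ h₂
        · have h₃ := hK.2.1.2.1 m h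
          cases t <;> exact lt_asymm h₂ h₃
      have hkk' : t.rel k k' := by
        simp only [List.pairwise_append, List.pairwise_cons, List.mem_cons] at hK
        exact hK.2.1.1 k' (by simp)
      cases t
      · exact (hG k' k hkk' hk.1 hk'.2 hk.2 fun m h₁ h₂ =>
          hbetween m (h₂.le.trans hk.1) h₂ h₁).2
      · exact (hG k k' hkk' hk'.1 hk.2 hk'.2 fun m h₁ h₂ =>
          hbetween m (h₂.le.trans hk'.1) h₁ h₂).1
    have := ih (K₁ := K₁ ++ [k]) (k := k') (by simpa using hK) (by simpa using hmem) (by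
      have h₁ : V ++ (K₁ ++ [k]).map (insertAt a π) =
          (V ++ K₁.map (insertAt a π)) ++ [insertAt a π k] := by simp
      have h₂ : V ++ (K₁ ++ [k] ++ [k']).map (insertAt a π) =
          (V ++ K₁.map (insertAt a π)) ++ [insertAt a π k] ++ [insertAt a π k'] := by simp
      rw [h₁] at h hs
      rw [h₂]
      exact .step h ⟨hs, hGs⟩)
    simpa using this

/-- Membership of both extreme positions is what makes a sweep start at one end of the permutation
and finish at the other. -/
theorem exists_positions (P : ℕ → Prop) {N : ℕ} (h₀ : P 0) (hN : P N) (t : Dir) :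
    ∃ K : List ℕ, K.Pairwise t.rel ∧ (∀ m, m ∈ K ↔ m ≤ N ∧ P m) ∧
      K.head? = some (t.start N) ∧
      K.getLast? = some (t.flip.start N) := by
  classical
  have key : ∃ K : List ℕ, K.Pairwise (· < ·) ∧ (∀ m, m ∈ K ↔ m ≤ N ∧ P m) ∧
      K.head? = some 0 ∧ K.getLast? = some N := by
    refine ⟨(List.range (N + 1)).filter (P ·), List.pairwise_lt_range.filter _,
      by simp, ?_, ?_⟩
    · simp [List.range_succ_eq_map, h₀]
    · simp [List.range_succ, hN]
  obtain ⟨K, h₁, h₂, h₃, h₄⟩ := key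
  cases t
  · exact ⟨K.reverse, by rw [List.pairwise_reverse]; exact h₁, by simpa using h₂,
      by rw [List.head?_reverse]; exact h₄, by rw [List.getLast?_reverse]; exact h₃⟩
  · exact ⟨K, h₁, h₂, h₃, h₄⟩

/-! ### Steps of smaller values while the largest value rests at an end -/

/-- The insertion of the largest value `a` at an end of a permutation. -/
structure IsEndInsertion (a : ℕ) (ι : List ℕ → List ℕ) : Prop where
  inj : Function.Injective ι
  jump_iff : ∀ t b d π σ, b < a → (Jump t b d (ι π) σ ↔ ∃ τ, σ = ι τ ∧ Jump t b d π τ)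
  mem_iff : ∀ π x, x ∈ ι π ↔ x = a ∨ x ∈ π

theorem isEndInsertion_cons (a : ℕ) : IsEndInsertion a (fun π => a :: π) where
  inj := List.cons_injective
  jump_iff _ _ _ _ _ hb := jump_cons hb
  mem_iff _ _ := List.mem_cons

theorem isEndInsertion_concat (a : ℕ) : IsEndInsertion a (fun π => π ++ [a]) where
  inj := List.append_left_injective [a]
  jump_iff _ _ _ _ _ hb := jump_concat hb
  mem_iff _ _ := by simp [or_comm]

/-- By `hno`, all jumps of `a` lead to visited permutations, so only smaller values provide
candidates, and these jump as they do without `a`. -/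
theorem IsEndInsertion.candidate_iff {ι : List ℕ → List ℕ} (hι : IsEndInsertion a ι)
    (hL : ∀ τ, ι τ ∈ L' ↔ τ ∈ L) {V V' : List (List ℕ)} (hlt : ∀ x ∈ π, x < a)
    (hV : ∀ τ ∈ L, ι τ ∈ V' ↔ τ ∈ V)
    (hno : ∀ t d σ, Jump t a d (ι π) σ → σ ∈ L' → σ ∈ V') (t : Dir) (b : ℕ) (σ : List ℕ) :
    Candidate L' V' (ι π) t b σ ↔ ∃ τ, σ = ι τ ∧ Candidate L V π t b τ := by
  constructor
  · rintro ⟨hσ, hσV, d, hj, hmin⟩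
    have hb := hj.value_mem
    rw [hι.mem_iff] at hb
    rcases hb with rfl | hb
    · exact absurd (hno _ _ _ hj hσ) hσV
    replace hb := hlt b hb
    obtain ⟨τ, rfl, hj'⟩ := (hι.jump_iff _ _ _ _ _ hb).mp hj
    rw [hL] at hσ
    refine ⟨τ, rfl, hσ, fun h => hσV ((hV τ hσ).mpr h), d, hj', fun d' hd' τ' hτ' hτ'L => ?_⟩
    exact hmin d' hd' _ ((hι.jump_iff _ _ _ _ _ hb).mpr ⟨τ', rfl, hτ'⟩) ((hL _).mpr hτ'L)
  · rintro ⟨τ, rfl, hτ, hτV, d, hj, hmin⟩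
    have hb := hlt b hj.value_mem
    refine ⟨(hL _).mpr hτ, fun h => hτV ((hV τ hτ).mp h), d,
      (hι.jump_iff _ _ _ _ _ hb).mpr ⟨τ, rfl, hj⟩, fun d' hd' σ hσ hσL => ?_⟩
    obtain ⟨τ', rfl, hτ'⟩ := (hι.jump_iff _ _ _ _ _ hb).mp hσ
    exact hmin d' hd' _ hτ' ((hL _).mp hσL)

theorem IsEndInsertion.jstep_iff {ι : List ℕ → List ℕ} (hι : IsEndInsertion a ι)
    (hL : ∀ τ, ι τ ∈ L' ↔ τ ∈ L) {V V' : List (List ℕ)} (hlt : ∀ x ∈ π, x < a)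
    (hV : ∀ τ ∈ L, ι τ ∈ V' ↔ τ ∈ V)
    (hno : ∀ t d σ, Jump t a d (ι π) σ → σ ∈ L' → σ ∈ V') (σ : List ℕ) :
    JStep L' V' (ι π) σ ↔ ∃ τ, σ = ι τ ∧ JStep L V π τ := by
  have key := hι.candidate_iff hL hlt hV hno
  constructor
  · rintro ⟨t, b, hc, hmax⟩
    obtain ⟨τ, rfl, hτ⟩ := (key _ _ _).mp hc
    exact ⟨τ, rfl, t, b, hτ, fun t' b' τ' h => hmax t' b' _ ((key _ _ _).mpr ⟨τ', rfl, h⟩)⟩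
  · rintro ⟨τ, rfl, t, b, hτ, hmax⟩
    refine ⟨t, b, (key _ _ _).mpr ⟨τ, rfl, hτ⟩, fun t' b' σ h => ?_⟩
    obtain ⟨τ', rfl, hτ'⟩ := (key _ _ _).mp h
    exact hmax _ _ _ hτ'

/-- The set `L'` of permutations arises from `L` by inserting the new largest value `a`, in every
permutation at least at both ends, such that `G'` is compatible with `G` at the ends. -/
structure ZigzagExtension (L L' : Set (List ℕ)) (G G' : List ℕ → List ℕ → Prop) (a : ℕ) :
    Prop where
  lt : ∀ π ∈ L, ∀ x ∈ π, x < a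
  exists_insertAt : ∀ σ ∈ L', ∃ π ∈ L, ∃ k ≤ π.length, σ = insertAt a π k
  cons_mem : ∀ π ∈ L, a :: π ∈ L'
  concat_mem : ∀ π ∈ L, π ++ [a] ∈ L'
  rel_cons : ∀ π σ, G π σ → G' (a :: π) (a :: σ)
  rel_concat : ∀ π σ, G π σ → G' (π ++ [a]) (σ ++ [a])
  consecutive : ∀ π ∈ L, ConsecutiveRelated L' G' a π

theorem ZigzagExtension.notMem (h : ZigzagExtension L L' G G' a) (hπ : π ∈ L) : a ∉ π :=
  fun h' => lt_irrefl _ (h.lt π hπ a h')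

/-- The set `L'` is that of all permutations in `L` with the new largest value `a` at the end. -/
structure TrivialExtension (L L' : Set (List ℕ)) (G G' : List ℕ → List ℕ → Prop) (a : ℕ) :
    Prop where
  lt : ∀ π ∈ L, ∀ x ∈ π, x < a
  mem_iff : ∀ σ, σ ∈ L' ↔ ∃ π ∈ L, σ = π ++ [a]
  rel_concat : ∀ π σ, G π σ → G' (π ++ [a]) (σ ++ [a])

theorem TrivialExtension.jstep_iff (h : TrivialExtension L L' G G' a) (hπ : π ∈ L)
    {V : List (List ℕ)} (hmem : π ∈ V) (σ : List ℕ) :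
    JStep L' (V.map (· ++ [a])) (π ++ [a]) σ ↔ ∃ τ, σ = τ ++ [a] ∧ JStep L V π τ := by
  refine (isEndInsertion_concat a).jstep_iff ?_ (h.lt π hπ) ?_ ?_ σ
  · intro τ
    rw [h.mem_iff]
    constructor
    · rintro ⟨ρ, hρ, he⟩
      rwa [(isEndInsertion_concat a).inj he]
    · exact fun hτ => ⟨τ, hτ, rfl⟩
  · intro τ _
    exact List.mem_map_of_injective (isEndInsertion_concat a).inj
  · intro t d σ hj hσ
    rw [← insertAt_length] at hj
    obtain ⟨k, hk, rfl⟩ := exists_insertAt_of_jump (h.lt π hπ) le_rfl hj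
    obtain ⟨ρ, hρ, he⟩ := (h.mem_iff _).mp hσ
    rw [← insertAt_length] at he
    obtain ⟨rfl, rfl⟩ := insertAt_inj (fun h' => lt_irrefl _ (h.lt π hπ a h'))
      (fun h' => lt_irrefl _ (h.lt ρ hρ a h')) hk le_rfl he
    rw [insertAt_length]
    exact List.mem_map_of_mem hmem

theorem TrivialExtension.isGrayRun (h : TrivialExtension L L' G G' a) (h₀ : π₀ ∈ L)
    {l : List (List ℕ)} (hl : IsGrayRun L G π₀ l) :
    IsGrayRun L' G' (π₀ ++ [a]) (l.map (· ++ [a])) where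
  history := by
    obtain ⟨hl, -, -⟩ := hl
    induction hl with
    | init => exact .init
    | @step l π σ hr hs ih =>
      have := (h.jstep_iff (hr.subset h₀ π (by simp)) (V := l ++ [π]) (by simp)
        (σ ++ [a])).mpr ⟨σ, rfl, hs.1⟩
      rw [List.map_append] at this ih
      rw [List.map_append, List.map_append]
      exact .step ih ⟨this, h.rel_concat _ _ hs.2⟩
  mem_iff σ := by
    rw [h.mem_iff, List.mem_map]
    constructor
    · rintro ⟨π, hπ, rfl⟩
      exact ⟨π, (hl.mem_iff π).mp hπ, rfl⟩
    · rintro ⟨π, hπ, rfl⟩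
      exact ⟨π, (hl.mem_iff π).mpr hπ, rfl⟩
  terminal := by
    intro π hπ σ hs
    rw [List.getLast?_map, Option.mem_map] at hπ
    obtain ⟨π, hπ, rfl⟩ := hπ
    have hmem := List.mem_of_mem_getLast? hπ
    obtain ⟨τ, -, hτ⟩ := (h.jstep_iff ((hl.mem_iff π).mp hmem) hmem σ).mp hs
    exact hl.terminal π hπ τ hτ

/-- `V'` consists of complete blocks over the permutations in `V`. Since the block over `π` is
exhausted, `a` cannot move, and the next step is that of the smaller run. -/
theorem ZigzagExtension.jstep_iff (h : ZigzagExtension L L' G G' a) (t : Dir) (hπ : π ∈ L) {V V' : List (List ℕ)}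
    (hVL : ∀ π ∈ V, π ∈ L)
    (hV : ∀ σ, σ ∈ V' ↔ ∃ π ∈ V, ∃ k ≤ π.length, σ = insertAt a π k ∧ σ ∈ L') (hmem : π ∈ V)
    (σ : List ℕ) : JStep L' V' (t.insertStart a π) σ ↔
      ∃ τ, σ = t.insertStart a τ ∧ JStep L V π τ := by
  set ι := t.insertStart a with hι
  have hι' : ∀ π, ∃ k ≤ π.length, ι π = insertAt a π k := fun π =>
    ⟨t.start π.length, by cases t <;> simp [Dir.start], (insertAt_start a t π).symm⟩
  have hend : IsEndInsertion a ι := by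
    cases t
    · exact isEndInsertion_concat a
    · exact isEndInsertion_cons a
  have hιL : ∀ π ∈ L, ι π ∈ L' := by
    cases t
    · exact h.concat_mem
    · exact h.cons_mem
  refine hend.jstep_iff ?_ (h.lt π hπ) ?_ ?_ σ
  · intro τ
    refine ⟨fun hτ => ?_, hιL τ⟩
    obtain ⟨ρ, hρ, k, hk, he⟩ := h.exists_insertAt _ hτ
    -- Members of `L'` contain `a` once. Hence `τ` avoids `a`, and the two insertions can be
    -- compared.
    have hcount : (ι τ).count a = 1 := by
      rw [he, (perm_insertAt a ρ k).count_eq]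
      simp [List.count_eq_zero.mpr (h.notMem hρ)]
    obtain ⟨j, hj, he'⟩ := hι' τ
    have ha : a ∉ τ := by
      rw [he', (perm_insertAt a τ j).count_eq] at hcount
      exact List.count_eq_zero.mp (by simpa using hcount)
    rw [he'] at he
    rwa [(insertAt_inj ha (h.notMem hρ) hj hk he).1]
  · intro τ hτ
    obtain ⟨j, hj, he'⟩ := hι' τ
    rw [hV]
    constructor
    · rintro ⟨ρ, hρ, k, hk, he, -⟩
      rw [he'] at he
      rwa [(insertAt_inj (h.notMem hτ) (h.notMem (hVL ρ hρ)) hj hk he).1]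
    · exact fun hτV => ⟨τ, hτV, j, hj, he', hιL τ hτ⟩
  · intro t d σ hj hσ
    obtain ⟨j, hj', he'⟩ := hι' π
    rw [he'] at hj
    obtain ⟨k, hk, rfl⟩ := exists_insertAt_of_jump (h.lt π hπ) hj' hj
    exact (hV _).mpr ⟨π, hmem, k, hk, rfl, hσ⟩

/-- The block of all insertions of `a` into `π`, in the given direction. -/
theorem ZigzagExtension.exists_block (h : ZigzagExtension L L' G G' a) (hπ : π ∈ L) (t : Dir)
    {σ₀ : List ℕ} {V : List (List ℕ)} (hV : ∀ m ≤ π.length, insertAt a π m ∉ V)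
    (hrun : RunHistory (GrayStep L' G') σ₀
      (V ++ [t.insertStart a π])) :
    ∃ B : List (List ℕ), RunHistory (GrayStep L' G') σ₀ (V ++ B) ∧
      (∀ σ, σ ∈ B ↔ ∃ k ≤ π.length, σ = insertAt a π k ∧ σ ∈ L') ∧
      B.getLast? = some (t.flip.insertStart a π) := by
  obtain ⟨K, hK, hmem, hhead, hlast⟩ := exists_positions (fun m => insertAt a π m ∈ L')
    (N := π.length) (by rw [insertAt_zero]; exact h.cons_mem π hπ)
    (by rw [insertAt_length]; exact h.concat_mem π hπ) t
  obtain ⟨k, K₂, rfl⟩ : ∃ k K₂, K = k :: K₂ := by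
    cases K with
    | nil => simp at hhead
    | cons k K₂ => exact ⟨k, K₂, rfl⟩
  refine ⟨(k :: K₂).map (insertAt a π), ?_, ?_, ?_⟩
  · refine RunHistory.block (K₁ := []) (h.lt π hπ) (h.consecutive π hπ) hK hmem hV ?_
    obtain rfl : k = t.start π.length := by simpa using hhead
    simpa [insertAt_start] using hrun
  · intro σ
    rw [List.mem_map]
    constructor
    · rintro ⟨m, hm, rfl⟩
      exact ⟨m, ((hmem m).mp hm).1, rfl, ((hmem m).mp hm).2⟩
    · rintro ⟨m, hm, rfl, hmL⟩
      exact ⟨m, (hmem m).mpr ⟨hm, hmL⟩, rfl⟩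
  · rw [List.getLast?_map, hlast, Option.map_some, insertAt_start]

/-- The invariant of the induction: the blocks over all visited permutations are complete, and `a`
rests at one of the two ends of the current one. Each new block turns the direction around. -/
theorem ZigzagExtension.exists_run (h : ZigzagExtension L L' G G' a) (h₀ : π₀ ∈ L)
    {l : List (List ℕ)} (hl : RunHistory (GrayStep L G) π₀ l) :
    ∃ l' : List (List ℕ), RunHistory (GrayStep L' G') (π₀ ++ [a]) l' ∧
      (∀ σ, σ ∈ l' ↔ ∃ π ∈ l, ∃ k ≤ π.length, σ = insertAt a π k ∧ σ ∈ L') ∧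
      ∀ π ∈ l.getLast?, ∃ t : Dir, l'.getLast? = some (t.insertStart a π) := by
  induction hl with
  | init =>
    obtain ⟨B, hB, hmem, hlast⟩ := h.exists_block h₀ .left (V := []) (by simp) .init
    refine ⟨B, by simpa [Dir.insertStart] using hB, by simpa using hmem, ?_⟩
    intro π hπ
    obtain rfl : π₀ = π := by simpa using hπ
    exact ⟨_, hlast⟩
  | @step l π σ hr hs ih =>
    obtain ⟨l', hl', hmem, hlast⟩ := ih
    obtain ⟨t, hlast⟩ := hlast π (by simp)
    have hσ : σ ∈ L := hs.1.mem
    have hsub := hr.subset h₀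
    have hstep := (h.jstep_iff t (hsub π (by simp)) hsub hmem (by simp) (t.insertStart a σ)).mpr
      ⟨σ, rfl, hs.1⟩
    have hV : ∀ m ≤ σ.length, insertAt a σ m ∉ l' := by
      intro m hm hml
      obtain ⟨ρ, hρ, k, hk, he, -⟩ := (hmem _).mp hml
      obtain ⟨rfl, -⟩ := insertAt_inj (h.notMem hσ) (h.notMem (hsub ρ hρ)) hm hk he
      exact hs.1.notMem hρ
    have hGt : G' (t.insertStart a π) (t.insertStart a σ) := by
      cases t
      · exact h.rel_concat _ _ hs.2
      · exact h.rel_cons _ _ hs.2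
    have hrun : RunHistory (GrayStep L' G') (π₀ ++ [a]) (l' ++ [t.insertStart a σ]) := by
      obtain ⟨m, rfl⟩ := List.getLast?_eq_some_iff.mp hlast
      exact .step hl' ⟨hstep, hGt⟩
    obtain ⟨B, hB, hBmem, hBlast⟩ := h.exists_block hσ t hV hrun
    refine ⟨l' ++ B, hB, ?_, ?_⟩
    · intro τ
      rw [List.mem_append, hmem, hBmem]
      simp only [List.mem_append (t := [σ]), List.mem_singleton, or_and_right, exists_or,
        exists_eq_left]
    · intro ρ hρ
      obtain rfl : σ = ρ := by simpa using hρ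
      exact ⟨t.flip, by rw [List.getLast?_append, hBlast]; rfl⟩

theorem ZigzagExtension.exists_isGrayRun (h : ZigzagExtension L L' G G' a) (h₀ : π₀ ∈ L)
    {l : List (List ℕ)} (hl : IsGrayRun L G π₀ l) :
    ∃ l', IsGrayRun L' G' (π₀ ++ [a]) l' := by
  obtain ⟨l', hl', hmem, hlast⟩ := h.exists_run h₀ hl.history
  refine ⟨l', hl', fun σ => ?_, fun σ hσ τ hτ => ?_⟩
  · rw [hmem]
    constructor
    · rintro ⟨_, _, _, _, _, hσ⟩
      exact hσ
    · intro hσ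
      obtain ⟨π, hπ, k, hk, rfl⟩ := h.exists_insertAt σ hσ
      exact ⟨π, (hl.mem_iff π).mpr hπ, k, hk, rfl, hσ⟩
  · obtain ⟨π, hπ⟩ : ∃ π, π ∈ l.getLast? :=
      ⟨_, List.getLast_mem_getLast? hl.history.ne_nil⟩
    have hπl := List.mem_of_mem_getLast? hπ
    obtain ⟨t, he⟩ := hlast π hπ
    obtain rfl : t.insertStart a π = σ := by rw [he] at hσ; simpa using hσ
    obtain ⟨ρ, -, hρ⟩ := (h.jstep_iff t ((hl.mem_iff π).mp hπl)
      (fun π hπ => (hl.mem_iff π).mp hπ) hmem hπl τ).mp hτ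
    exact hl.terminal π hπ ρ hρ

end

/-! ### Orientations and linear extensions -/

theorem idxOf_insertAt_self {a k : ℕ} {π : List ℕ} (ha : a ∉ π) (hk : k ≤ π.length) :
    (insertAt a π k).idxOf a = k := by
  induction π generalizing k with
  | nil => obtain rfl : k = 0 := by simpa using hk
           simp [insertAt]
  | cons x π ih =>
    cases k with
    | zero => simp [insertAt]
    | succ k =>
      simp only [List.mem_cons, not_or] at ha
      have : insertAt a (x :: π) (k + 1) = x :: insertAt a π k := rfl
      rw [this, List.idxOf_cons_ne _ (Ne.symm ha.1), ih ha.2 (by simpa using hk)]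

theorem idxOf_insertAt_of_ne {a u k : ℕ} {π : List ℕ} (hu : u ≠ a) (hk : k ≤ π.length) :
    (insertAt a π k).idxOf u = if π.idxOf u < k then π.idxOf u else π.idxOf u + 1 := by
  induction π generalizing k with
  | nil => obtain rfl : k = 0 := by simpa using hk
           simp [insertAt, List.idxOf_cons_ne _ hu.symm]
  | cons x π ih =>
    cases k with
    | zero => simp [insertAt, List.idxOf_cons_ne _ hu.symm]
    | succ k =>
      have : insertAt a (x :: π) (k + 1) = x :: insertAt a π k := rfl
      rw [this]
      by_cases hx : x = u
      · subst hx; simp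
      · rw [List.idxOf_cons_ne _ hx, List.idxOf_cons_ne _ hx, ih (by simpa using hk)]
        split_ifs <;> omega

namespace HyperOrientation

variable {E : Finset (Finset ℕ)} {h h' : HyperOrientation E} {π : List ℕ}

/-- The list `π` is a linear extension of the arcs of `h`: every head is the last vertex of its
hyperedge. -/
def Respects (h : HyperOrientation E) (π : List ℕ) : Prop :=
  ∀ A : {A : Finset ℕ // A ∈ E}, ∀ u ∈ A.1, π.idxOf u ≤ π.idxOf (h.head A)

/-- The condition `hπ` is needed to break ties: `idxOf` is injective on entries of `π`, but takes
the common default value `π.length` on all other vertices. -/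
theorem Respects.head_eq (hr : h.Respects π) (hπ : ∀ A ∈ E, ∀ u ∈ A, u ∈ π)
    (A : {A : Finset ℕ // A ∈ E}) {v : ℕ} (hv : v ∈ A.1)
    (hmax : ∀ u ∈ A.1, π.idxOf u ≤ π.idxOf v) : h.head A = v :=
  (List.idxOf_inj (hπ _ A.2 _ (h.head_mem A))).mp
    (le_antisymm (hmax _ (h.head_mem A)) (hr A v hv))

theorem Respects.unique (hr : h.Respects π) (hr' : h'.Respects π)
    (hπ : ∀ A ∈ E, ∀ u ∈ A, u ∈ π) : h = h' := by
  ext A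
  exact hr.head_eq hπ A (h'.head_mem A) (hr' A)

theorem Respects.idxOf_lt_of_arc (hr : h.Respects π) (hπ : ∀ A ∈ E, ∀ u ∈ A, u ∈ π) {i j : ℕ}
    (hij : h.Arc i j) : π.idxOf i < π.idxOf j := by
  obtain ⟨hne, A, hi, hj, rfl⟩ := hij
  exact lt_of_le_of_ne (hr A i hi) fun he => hne ((List.idxOf_inj (hπ _ A.2 _ hi)).mp he)

theorem Respects.idxOf_lt_of_below (hr : h.Respects π) (hπ : ∀ A ∈ E, ∀ u ∈ A, u ∈ π) {i j : ℕ}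
    (hij : h.Below i j) : π.idxOf i < π.idxOf j := by
  induction hij with
  | single hij => exact hr.idxOf_lt_of_arc hπ hij
  | tail _ hij ih => exact ih.trans (hr.idxOf_lt_of_arc hπ hij)

theorem Respects.isAcyclic (hr : h.Respects π) (hπ : ∀ A ∈ E, ∀ u ∈ A, u ∈ π) : h.IsAcyclic :=
  fun _ hi => lt_irrefl _ (hr.idxOf_lt_of_below hπ hi)

theorem exists_respects (hE : ∀ A ∈ E, A.Nonempty) (π : List ℕ) :
    ∃ h : HyperOrientation E, h.Respects π := by
  have key : ∀ A : {A : Finset ℕ // A ∈ E}, ∃ v ∈ A.1, ∀ u ∈ A.1, π.idxOf u ≤ π.idxOf v :=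
    fun A => A.1.exists_max_image _ (hE A.1 A.2)
  choose f hf hmax using key
  exact ⟨⟨f, hf⟩, hmax⟩

theorem arc_head (h : HyperOrientation E) (A : {A : Finset ℕ // A ∈ E}) {u : ℕ} (hu : u ∈ A.1)
    (hne : u ≠ h.head A) : h.Arc u (h.head A) :=
  ⟨hne, A, hu, h.head_mem A, rfl⟩

theorem IsAcyclic.not_arc_arc (hh : h.IsAcyclic) {i j : ℕ} (hij : h.Arc i j) (hji : h.Arc j i) :
    False :=
  hh i (.tail (.single hij) hji)

/-- Two heads of hyperedges that each contain the other head are equal. -/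
theorem IsAcyclic.head_eq_head (hh : h.IsAcyclic) {A B : {A : Finset ℕ // A ∈ E}}
    (hA : h.head A ∈ B.1) (hB : h.head B ∈ A.1) : h.head A = h.head B := by
  by_contra hne
  exact hh.not_arc_arc (h.arc_head B hA hne) (h.arc_head A hB (Ne.symm hne))

theorem Arc.of_restrict {m i j : ℕ} (hij : (h.restrict m).Arc i j) : h.Arc i j := by
  obtain ⟨hne, A, hi, hj, he⟩ := hij
  exact ⟨hne, ⟨A.1, (Finset.mem_filter.mp A.2).1⟩, hi, hj, he⟩

theorem IsAcyclic.restrict (hh : h.IsAcyclic) (m : ℕ) : (h.restrict m).IsAcyclic :=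
  fun i hi => hh i (Relation.TransGen.mono (fun _ _ hij => Arc.of_restrict (h := h) hij) i i hi)

end HyperOrientation

/-! ### Chordal building sets -/

section

variable {n : ℕ} {E : Finset (Finset ℕ)}

theorem mem_inducedEdges {m : ℕ} {A : Finset ℕ} :
    A ∈ inducedEdges E m ↔ A ∈ E ∧ A ⊆ Finset.Icc 1 m := Finset.mem_filter

theorem IsChordalBuildingSet.induced (hE : IsChordalBuildingSet (n + 1) E) :
    IsChordalBuildingSet n (inducedEdges E n) where
  subset A hA := (mem_inducedEdges.mp hA).2
  nonempty A hA := hE.nonempty A (mem_inducedEdges.mp hA).1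
  singleton_mem v hv := mem_inducedEdges.mpr
    ⟨hE.singleton_mem v (Finset.Icc_subset_Icc_right n.le_succ hv), by simpa using hv⟩
  union_mem A hA B hB hAB := by
    rw [mem_inducedEdges] at *
    exact ⟨hE.union_mem A hA.1 B hB.1 hAB, Finset.union_subset hA.2 hB.2⟩
  initial_mem A hA k hk := by
    rw [mem_inducedEdges] at *
    exact ⟨hE.initial_mem A hA.1 k hk, (Finset.filter_subset _ _).trans hA.2⟩

theorem IsBuildingSet.subset_of_notMem (hE : IsBuildingSet (n + 1) E) {A : Finset ℕ}
    (hA : A ∈ E) (hn : n + 1 ∉ A) : A ⊆ Finset.Icc 1 n := by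
  intro x hx
  have := Finset.mem_Icc.mp (hE.subset A hA hx)
  rw [Finset.mem_Icc]
  have : x ≠ n + 1 := fun h => hn (h ▸ hx)
  omega

/-- This is where chordality enters: `A` without its largest possible vertex is the initial part of
`A` up to the largest remaining vertex. -/
theorem IsChordalBuildingSet.erase_mem (hE : IsChordalBuildingSet (n + 1) E) {A : Finset ℕ}
    (hA : A ∈ E) {u : ℕ} (hu : u ∈ A) (hun : u ≠ n + 1) : A.erase (n + 1) ∈ E := by
  have hne : (A.erase (n + 1)).Nonempty := ⟨u, by simp [hu, hun]⟩
  have hmax := Finset.mem_erase.mp (Finset.max'_mem _ hne)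
  convert hE.initial_mem A hA _ hmax.2 using 1
  ext x
  rw [Finset.mem_erase, Finset.mem_filter, and_comm]
  refine and_congr_right fun hx => ⟨fun h => Finset.le_max' _ _ (by simp [hx, h]), fun h => ?_⟩
  rintro rfl
  have := Finset.mem_Icc.mp (hE.subset A hA hmax.2)
  omega

theorem IsChordalBuildingSet.erase_mem_inducedEdges (hE : IsChordalBuildingSet (n + 1) E)
    {A : Finset ℕ} (hA : A ∈ E) {u : ℕ} (hu : u ∈ A) (hun : u ≠ n + 1) :
    A.erase (n + 1) ∈ inducedEdges E n :=
  mem_inducedEdges.mpr ⟨hE.erase_mem hA hu hun,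
    hE.subset_of_notMem (hE.erase_mem hA hu hun) (by simp)⟩

/-- If the largest vertex is not the head of a hyperedge, then its removal preserves the head. -/
theorem IsChordalBuildingSet.head_restrict_erase (hE : IsChordalBuildingSet (n + 1) E)
    {h : HyperOrientation E} (hh : h.IsAcyclic) {A : {A : Finset ℕ // A ∈ E}}
    (hne : h.head A ≠ n + 1) :
    (h.restrict n).head ⟨A.1.erase (n + 1), hE.erase_mem_inducedEdges A.2 (h.head_mem A) hne⟩ =
      h.head A := by
  have hmem : A.1.erase (n + 1) ∈ E := hE.erase_mem A.2 (h.head_mem A) hne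
  change h.head ⟨A.1.erase (n + 1), hmem⟩ = h.head A
  exact hh.head_eq_head (Finset.mem_of_mem_erase (h.head_mem ⟨_, hmem⟩))
    (Finset.mem_erase.mpr ⟨hne, h.head_mem A⟩)

/-! ### The permutation of an acyclic orientation is a linear extension -/

theorem mem_range'_one {x : ℕ} : x ∈ List.range' 1 n ↔ x ∈ Finset.Icc 1 n := by
  rw [List.mem_range'_1, Finset.mem_Icc]
  omega

theorem notMem_of_perm {π : List ℕ} (hπ : π.Perm (List.range' 1 n)) : n + 1 ∉ π := by
  rw [hπ.mem_iff, mem_range'_one, Finset.mem_Icc]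
  omega

theorem length_of_perm {π : List ℕ} (hπ : π.Perm (List.range' 1 n)) : π.length = n := by
  simpa using hπ.length_eq

theorem insertAt_perm {π : List ℕ} (hπ : π.Perm (List.range' 1 n)) (k : ℕ) :
    (insertAt (n + 1) π k).Perm (List.range' 1 (n + 1)) := by
  refine (perm_insertAt _ _ _).trans ?_
  rw [List.range'_1_concat, add_comm 1 n]
  exact (hπ.cons _).trans (List.perm_append_singleton _ _).symm

theorem IsBuildingSet.mem_of_perm (hE : IsBuildingSet n E) {π : List ℕ}
    (hπ : π.Perm (List.range' 1 n)) : ∀ A ∈ E, ∀ u ∈ A, u ∈ π := by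
  intro A hA u hu
  rw [hπ.mem_iff, mem_range'_one]
  exact hE.subset A hA hu

theorem idxOf_le_idxOf_insertAt {a u v k : ℕ} {π : List ℕ} (hu : u ≠ a) (hv : v ≠ a)
    (hk : k ≤ π.length) :
    (insertAt a π k).idxOf u ≤ (insertAt a π k).idxOf v ↔ π.idxOf u ≤ π.idxOf v := by
  rw [idxOf_insertAt_of_ne hu hk, idxOf_insertAt_of_ne hv hk]
  split_ifs <;> omega

theorem idxOf_self_le_idxOf_insertAt {a v k : ℕ} {π : List ℕ} (ha : a ∉ π) (hv : v ≠ a)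
    (hk : k ≤ π.length) :
    (insertAt a π k).idxOf a ≤ (insertAt a π k).idxOf v ↔ k ≤ π.idxOf v := by
  rw [idxOf_insertAt_self ha hk, idxOf_insertAt_of_ne hv hk]
  split_ifs <;> omega

theorem idxOf_le_idxOf_self_insertAt {a u k : ℕ} {π : List ℕ} (ha : a ∉ π) (hu : u ≠ a)
    (hk : k ≤ π.length) :
    (insertAt a π k).idxOf u ≤ (insertAt a π k).idxOf a ↔ π.idxOf u < k := by
  rw [idxOf_insertAt_self ha hk, idxOf_insertAt_of_ne hu hk]
  split_ifs <;> omega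

/-- A linear extension of the restriction, with the largest vertex inserted before the heads of
those hyperedges that contain it and do not have it as head, and after all vertices in the other
hyperedges that contain it, is a linear extension. -/
theorem IsChordalBuildingSet.respects_insertAt (hE : IsChordalBuildingSet (n + 1) E)
    {h : HyperOrientation E} (hh : h.IsAcyclic) {π : List ℕ} (hπ : π.Perm (List.range' 1 n))
    (hr : (h.restrict n).Respects π) {k : ℕ} (hk : k ≤ n)
    (h₁ : ∀ A, h.head A = n + 1 → ∀ u ∈ A.1, u ≠ n + 1 → π.idxOf u < k)
    (h₂ : ∀ A, n + 1 ∈ A.1 → h.head A ≠ n + 1 → k ≤ π.idxOf (h.head A)) :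
    h.Respects (insertAt (n + 1) π k) := by
  have ha := notMem_of_perm hπ
  have hk' : k ≤ π.length := by rwa [length_of_perm hπ]
  intro A u hu
  by_cases hA : h.head A = n + 1
  · rw [hA]
    by_cases hun : u = n + 1
    · rw [hun]
    · rw [idxOf_le_idxOf_self_insertAt ha hun hk']
      exact h₁ A hA u hu hun
  · by_cases hun : u = n + 1
    · rw [hun, idxOf_self_le_idxOf_insertAt ha hA hk']
      exact h₂ A (hun ▸ hu) hA
    · rw [idxOf_le_idxOf_insertAt hun hA hk', ← hE.head_restrict_erase hh hA]
      exact hr _ u (Finset.mem_erase.mpr ⟨hun, hu⟩)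

theorem perm_succ_of_isMaxVertex {h : HyperOrientation E} (hmax : h.IsMaxVertex (n + 1)) :
    perm (n + 1) h = perm n (h.restrict n) ++ [n + 1] := by
  rw [perm, if_pos hmax]

theorem perm_succ_of_isMinVertex {h : HyperOrientation E} (hmax : ¬ h.IsMaxVertex (n + 1))
    (hmin : h.IsMinVertex (n + 1)) : perm (n + 1) h = (n + 1) :: perm n (h.restrict n) := by
  rw [perm, if_neg hmax, if_pos hmin]

theorem perm_succ_of_coveredBy {h : HyperOrientation E} (hmax : ¬ h.IsMaxVertex (n + 1))
    (hmin : ¬ h.IsMinVertex (n + 1)) {v : ℕ} (hv : h.CoveredBy (n + 1) v)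
    (huniq : ∀ w, h.CoveredBy (n + 1) w → w = v) :
    perm (n + 1) h = (perm n (h.restrict n)).insertIdx
      ((perm n (h.restrict n)).idxOf v) (n + 1) := by
  have hu : ∃! v, h.CoveredBy (n + 1) v := ⟨v, hv, huniq⟩
  rw [perm, if_neg hmax, if_neg hmin, dif_pos hu, huniq _ hu.choose_spec.1]

/-- The inductive step: `n + 1` is inserted at a position that yields a linear extension. -/
theorem IsChordalBuildingSet.perm_succ (hE : IsChordalBuildingSet (n + 1) E)
    {h : HyperOrientation E} (hh : h.IsAcyclic)
    (hπ : (perm n (h.restrict n)).Perm (List.range' 1 n))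
    (hr : (h.restrict n).Respects (perm n (h.restrict n))) :
    ∃ k ≤ n, perm (n + 1) h = insertAt (n + 1) (perm n (h.restrict n)) k ∧
      h.Respects (insertAt (n + 1) (perm n (h.restrict n)) k) := by
  have hlen := length_of_perm hπ
  have hmemπ : ∀ x, x ∈ perm n (h.restrict n) ↔ x ∈ Finset.Icc 1 n := fun x => by
    rw [hπ.mem_iff, mem_range'_one]
  by_cases hmax : h.IsMaxVertex (n + 1)
  · refine ⟨n, le_rfl, ?_, ?_⟩
    · have := insertAt_length (n + 1) (perm n (h.restrict n))
      rw [hlen] at this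
      rw [this, perm_succ_of_isMaxVertex hmax]
    · refine hE.respects_insertAt hh hπ hr le_rfl ?_ ?_
      · intro A hA u hu hun
        have : u ∈ perm n (h.restrict n) := by
          rw [hmemπ, Finset.mem_Icc]
          have := Finset.mem_Icc.mp (hE.subset A.1 A.2 hu)
          omega
        simpa [hlen] using List.idxOf_lt_length_iff.mpr this
      · intro A hA hne
        exact absurd (.single (h.arc_head A hA (Ne.symm hne))) (hmax _)
  by_cases hmin : h.IsMinVertex (n + 1)
  · refine ⟨0, Nat.zero_le _, perm_succ_of_isMinVertex hmax hmin, ?_⟩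
    refine hE.respects_insertAt hh hπ hr (Nat.zero_le _) ?_ fun _ _ _ => Nat.zero_le _
    intro A hA u hu hun
    exact absurd (.single (hA ▸ h.arc_head A hu (by rwa [hA]))) (hmin u)
  generalize hρ : perm n (h.restrict n) = π at *
  classical
  let S : Finset {A : Finset ℕ // A ∈ E} :=
    Finset.univ.filter fun A => n + 1 ∈ A.1 ∧ h.head A ≠ n + 1
  have hS : S.Nonempty := by
    simp only [HyperOrientation.IsMaxVertex, not_forall, not_not] at hmax
    obtain ⟨j, hj⟩ := hmax
    obtain ⟨u, ⟨hne, A, hA, hu, he⟩, -⟩ := (Relation.TransGen.head'_iff).mp hj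
    exact ⟨A, by simpa [S] using ⟨hA, by rw [he]; exact hne.symm⟩⟩
  -- Among the hyperedges that contain `n + 1` with another head, `B` is one whose head `v` comes
  -- first in `π`. Inserting `n + 1` directly before `v` is then early enough for all of them, and
  -- `v` will turn out to be the unique cover.
  obtain ⟨B, hB, hBmin⟩ := S.exists_min_image (fun A => π.idxOf (h.head A)) hS
  obtain ⟨hnB, hBne⟩ : n + 1 ∈ B.1 ∧ h.head B ≠ n + 1 := by simpa [S] using hB
  replace hBmin : ∀ A, n + 1 ∈ A.1 → h.head A ≠ n + 1 → π.idxOf (h.head B) ≤ π.idxOf (h.head A) :=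
    fun A h₁ h₂ => hBmin A (by simpa [S] using ⟨h₁, h₂⟩)
  set v := h.head B with hv
  have hvπ : v ∈ π := by
    rw [hmemπ, Finset.mem_Icc]
    have := Finset.mem_Icc.mp (hE.subset B.1 B.2 (h.head_mem B))
    omega
  have hvlt : π.idxOf v < n := by simpa [hlen] using List.idxOf_lt_length_iff.mpr hvπ
  have hunion : ∀ A : {A : Finset ℕ // A ∈ E}, n + 1 ∈ A.1 → A.1 ∪ B.1 ∈ E := fun A hA =>
    hE.union_mem _ A.2 _ B.2 ⟨n + 1, Finset.mem_inter.mpr ⟨hA, hnB⟩⟩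
  -- If `C` contains `B` and has head `n + 1`, then each of the two hyperedges contains the head of
  -- the other, which forces equal heads.
  have hheadC : ∀ C : {A : Finset ℕ // A ∈ E}, B.1 ⊆ C.1 → h.head C ≠ n + 1 := by
    intro C hC he
    exact hBne ((hh.head_eq_head (A := B) (B := C) (hC (h.head_mem B)) (by rwa [he])).trans he)
  have hresp : h.Respects (insertAt (n + 1) π (π.idxOf v)) := by
    refine hE.respects_insertAt hh hπ hr hvlt.le ?_ hBmin
    intro A hA u hu hun
    have hnA : n + 1 ∈ A.1 := hA ▸ h.head_mem A
    have hC := hunion A hnA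
    have hCne := hheadC ⟨_, hC⟩ Finset.subset_union_right
    -- The head of `A ∪ B` cannot lie in `A`, since it would agree with the head `n + 1` of `A`. So
    -- it is the head `v` of `B`, and all vertices of `A` other than `n + 1` precede `v` in `π`.
    have hCv : h.head ⟨_, hC⟩ = v := by
      rcases Finset.mem_union.mp (h.head_mem ⟨_, hC⟩) with hm | hm
      · have := hh.head_eq_head (A := ⟨_, hC⟩) (B := A) hm
          (Finset.mem_union_left _ (h.head_mem A))
        exact absurd (this.trans hA) hCne
      · exact hh.head_eq_head (A := ⟨_, hC⟩) (B := B) hm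
          (Finset.mem_union_right _ (h.head_mem B))
    have huC : u ∈ (A.1 ∪ B.1).erase (n + 1) :=
      Finset.mem_erase.mpr ⟨hun, Finset.mem_union_left _ hu⟩
    have hle := hr ⟨_, hE.erase_mem_inducedEdges hC (h.head_mem ⟨_, hC⟩) hCne⟩ u huC
    rw [hE.head_restrict_erase hh (A := ⟨_, hC⟩) hCne, hCv] at hle
    refine lt_of_le_of_ne hle fun he => ?_
    have huπ : u ∈ π := by
      rw [hmemπ, Finset.mem_Icc]
      have := Finset.mem_Icc.mp (hE.subset A.1 A.2 hu)
      omega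
    obtain rfl : u = v := (List.idxOf_inj huπ).mp he
    have := hh.head_eq_head (A := B) (B := A) hu (by rwa [hA])
    exact hBne (this.trans hA)
  have hlt_of_below := fun {i j : ℕ} => hresp.idxOf_lt_of_below (i := i) (j := j)
    (hE.mem_of_perm (insertAt_perm hπ _))
  -- The head of `A ∪ B` is that of `A` or that of `B`. In the first case `v` is below or equal to
  -- the head of `A`; in the second, a head of `A` other than `v` would precede `v`, against the
  -- choice of `B`.
  have harc : ∀ u, h.Arc (n + 1) u → u = v ∨ h.Below v u := by
    rintro u ⟨hne, A, hA, hu, rfl⟩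
    have hC := hunion A hA
    rcases Finset.mem_union.mp (h.head_mem ⟨_, hC⟩) with hm | hm
    · have hCA := hh.head_eq_head (A := ⟨_, hC⟩) (B := A) hm
        (Finset.mem_union_left _ (h.head_mem A))
      by_cases hvA : v = h.head A
      · exact Or.inl hvA.symm
      · right
        rw [← hCA]
        exact .single (h.arc_head ⟨_, hC⟩ (Finset.mem_union_right _ (h.head_mem B))
          (by rw [hCA]; exact hvA))
    · have hCB := hh.head_eq_head (A := ⟨_, hC⟩) (B := B) hm
        (Finset.mem_union_right _ (h.head_mem B))
      by_cases huv : h.head A = v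
      · exact Or.inl huv
      · exfalso
        have harc : h.Arc (h.head A) v := by
          rw [hv, ← hCB]
          exact h.arc_head ⟨_, hC⟩ (Finset.mem_union_left _ (h.head_mem A))
            (by rw [hCB]; exact huv)
        have h₁ := hlt_of_below (.single harc)
        have h₂ := hBmin A hA hne.symm
        have := (idxOf_le_idxOf_insertAt hBne hne.symm
          (by rw [hlen]; exact hvlt.le : π.idxOf v ≤ π.length)).mpr h₂
        omega
  have hbelow : ∀ k, h.Below (n + 1) k → k = v ∨ h.Below v k := by
    intro k hk
    obtain ⟨u, hu, huk⟩ := Relation.TransGen.head'_iff.mp hk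
    rcases harc u hu with rfl | hvu
    · rcases Relation.reflTransGen_iff_eq_or_transGen.mp huk with h | h
      · exact Or.inl h
      · exact Or.inr h
    · exact Or.inr (hvu.trans_left huk)
  have hnv : h.Below (n + 1) v := .single (h.arc_head B hnB (Ne.symm hBne))
  have hcov : h.CoveredBy (n + 1) v := by
    refine ⟨hnv, fun k ⟨h₁, h₂⟩ => ?_⟩
    rcases hbelow k h₁ with rfl | h₃
    · exact hh _ h₂
    · exact hh _ (h₃.trans h₂)
  have huniq : ∀ w, h.CoveredBy (n + 1) w → w = v := by
    intro w hw
    rcases hbelow w hw.1 with h₁ | h₁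
    · exact h₁
    · exact absurd ⟨hnv, h₁⟩ (hw.2 v)
  refine ⟨π.idxOf v, hvlt.le, ?_, hresp⟩
  rw [perm_succ_of_coveredBy hmax hmin hcov huniq, hρ,
    insertIdx_eq_insertAt _ _ _ (by rw [hlen]; exact hvlt.le)]

/-- The permutation of an acyclic orientation is a permutation of `[n]` and a linear extension. -/
theorem IsChordalBuildingSet.perm_spec (hE : IsChordalBuildingSet n E)
    {h : HyperOrientation E} (hh : h.IsAcyclic) :
    (perm n h).Perm (List.range' 1 n) ∧ h.Respects (perm n h) := by
  induction n generalizing E with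
  | zero =>
    refine ⟨by simp [perm], fun A u hu => ?_⟩
    have := Finset.mem_Icc.mp (hE.subset A.1 A.2 hu)
    omega
  | succ n ih =>
    obtain ⟨hπ, hr⟩ := ih hE.induced (hh.restrict n)
    obtain ⟨k, -, he, hk⟩ := hE.perm_succ hh hπ hr
    rw [he]
    exact ⟨insertAt_perm hπ k, hk⟩

end

/-! ### The Gray code of acyclic orientations -/

section

variable {n : ℕ} {E : Finset (Finset ℕ)}

theorem IsBuildingSet.exists_respects (hE : IsBuildingSet n E) {π : List ℕ}
    (hπ : π.Perm (List.range' 1 n)) : ∃ h : AO E, h.1.Respects π := by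
  obtain ⟨h, hr⟩ := HyperOrientation.exists_respects hE.nonempty π
  exact ⟨⟨h, hr.isAcyclic (hE.mem_of_perm hπ)⟩, hr⟩

theorem IsBuildingSet.respects_unique (hE : IsBuildingSet n E) {π : List ℕ}
    (hπ : π.Perm (List.range' 1 n)) {h h' : AO E} (hr : h.1.Respects π)
    (hr' : h'.1.Respects π) : h = h' :=
  Subtype.ext (hr.unique hr' (hE.mem_of_perm hπ))

theorem IsChordalBuildingSet.perm_injective (hE : IsChordalBuildingSet n E) :
    Function.Injective fun h : AO E => perm n h.1 := by
  intro h h' he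
  replace he : perm n h.1 = perm n h'.1 := he
  refine hE.respects_unique (hE.perm_spec h.2).1 (hE.perm_spec h.2).2 ?_
  rw [he]
  exact (hE.perm_spec h'.2).2

/-- The restriction of an acyclic orientation. -/
def AO.restrict (h : AO E) (m : ℕ) : AO (inducedEdges E m) := ⟨h.1.restrict m, h.2.restrict m⟩

theorem AO.respects_restrict {h : AO E} {π : List ℕ} {k : ℕ} (hk : k ≤ π.length)
    (hr : h.1.Respects (insertAt (n + 1) π k)) : (h.restrict n).1.Respects π := by
  intro A u hu
  have hne : ∀ x ∈ A.1, x ≠ n + 1 := by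
    intro x hx
    have := Finset.mem_Icc.mp ((mem_inducedEdges.mp A.2).2 hx)
    omega
  rw [← idxOf_le_idxOf_insertAt (hne u hu) (hne _ ((h.restrict n).1.head_mem A)) hk]
  exact hr ⟨A.1, (mem_inducedEdges.mp A.2).1⟩ u hu

theorem IsChordalBuildingSet.restrict_eq (hE : IsChordalBuildingSet (n + 1) E)
    {h : AO E} {h₀ : AO (inducedEdges E n)} {k : ℕ} (hk : k ≤ n)
    (hr : h.1.Respects (insertAt (n + 1) (perm n h₀.1) k)) : h.restrict n = h₀ := by
  obtain ⟨hπ, hr₀⟩ := hE.induced.perm_spec h₀.2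
  exact hE.induced.respects_unique hπ
    (AO.respects_restrict (by rwa [length_of_perm hπ]) hr) hr₀

/-- The orientation compatible with some insertion into `perm n h₀.1` restricts to `h₀`, so its own
permutation is an insertion into the same list, possibly at another position `r`. -/
theorem IsChordalBuildingSet.exists_perm_eq (hE : IsChordalBuildingSet (n + 1) E)
    {h : AO E} {h₀ : AO (inducedEdges E n)} {k : ℕ} (hk : k ≤ n)
    (hr : h.1.Respects (insertAt (n + 1) (perm n h₀.1) k)) :
    ∃ r ≤ n, perm (n + 1) h.1 = insertAt (n + 1) (perm n h₀.1) r ∧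
      h.1.Respects (insertAt (n + 1) (perm n h₀.1) r) := by
  have he := hE.restrict_eq hk hr
  obtain ⟨hπ, hr₀⟩ := hE.induced.perm_spec (h.restrict n).2
  have := hE.perm_succ h.2 hπ hr₀
  rwa [show h.1.restrict n = h₀.1 from congrArg Subtype.val he] at this

/-- Hyperedges with head `a` bound the position of `a` from below, other hyperedges containing `a`
bound it from above, and the remaining ones do not depend on it. So the compatible positions form an
interval. -/
theorem respects_insertAt_of_between {h : HyperOrientation E} {a i j k : ℕ} {π : List ℕ}
    (ha : a ∉ π) (hij : i ≤ j) (hjk : j ≤ k) (hk : k ≤ π.length)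
    (hi : h.Respects (insertAt a π i)) (hk' : h.Respects (insertAt a π k)) :
    h.Respects (insertAt a π j) := by
  intro A u hu
  have h₁ := hi A u hu
  have h₂ := hk' A u hu
  by_cases hua : u = a
  · by_cases hA : h.head A = a
    · rw [hua, hA]
    · rw [hua, idxOf_self_le_idxOf_insertAt ha hA hk] at h₂
      rw [hua, idxOf_self_le_idxOf_insertAt ha hA (hjk.trans hk)]
      exact hjk.trans h₂
  · by_cases hA : h.head A = a
    · rw [hA, idxOf_le_idxOf_self_insertAt ha hua (hij.trans (hjk.trans hk))] at h₁
      rw [hA, idxOf_le_idxOf_self_insertAt ha hua (hjk.trans hk)]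
      exact h₁.trans_le hij
    · rw [idxOf_le_idxOf_insertAt hua hA hk] at h₂
      rwa [idxOf_le_idxOf_insertAt hua hA (hjk.trans hk)]

/-- Moving `a` across one entry flips at most one pair. -/
theorem eq_or_pairFlip_of_respects
    {h h' : HyperOrientation E} {a k : ℕ} {π : List ℕ} (ha : a ∉ π) (hn : π.Nodup)
    (hk : k < π.length) (hE : ∀ A ∈ E, ∀ u ∈ A, u = a ∨ u ∈ π)
    (hr : h.Respects (insertAt a π (k + 1))) (hr' : h'.Respects (insertAt a π k)) :
    h = h' ∨ h.PairFlip h' π[k] a := by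
  refine or_iff_not_imp_left.mpr fun hne => ⟨fun he => ha (he ▸ List.getElem_mem hk), Ne.symm hne,
    fun A => ?_⟩
  have hidx : π.idxOf π[k] = k := hn.idxOf_getElem k hk
  have hinj : ∀ u ∈ A.1, u ≠ a → π.idxOf u = k → u = π[k] := by
    intro u hu hua he
    have huπ := (hE A.1 A.2 u hu).resolve_left hua
    rw [← hidx] at he
    exact (List.idxOf_inj huπ).mp he
  have hmem : ∀ A ∈ E, ∀ u ∈ A, u ∈ insertAt a π k := fun A hA u hu =>
    mem_insertAt.mpr (hE A hA u hu)
  split_ifs with hc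
  · refine hr'.head_eq hmem A hc.2 fun u hu => ?_
    have hva : π[k] ≠ a := fun he => ha (he ▸ List.getElem_mem hk)
    by_cases hua : u = a
    · rw [hua, idxOf_self_le_idxOf_insertAt ha hva hk.le, hidx]
    · have := hr A u hu
      rw [hc.1, idxOf_le_idxOf_self_insertAt ha hua hk] at this
      rw [idxOf_le_idxOf_insertAt hua hva hk.le, hidx]
      omega
  · refine hr'.head_eq hmem A (h.head_mem A) fun u hu => ?_
    have h₁ := hr A u hu
    by_cases hua : u = a
    · by_cases hA : h.head A = a
      · rw [hua, hA]
      · rw [hua, idxOf_self_le_idxOf_insertAt ha hA hk] at h₁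
        rw [hua, idxOf_self_le_idxOf_insertAt ha hA hk.le]
        omega
    · by_cases hA : h.head A = a
      · rw [hA, idxOf_le_idxOf_self_insertAt ha hua hk] at h₁
        rw [hA, idxOf_le_idxOf_self_insertAt ha hua hk.le]
        have : π.idxOf u ≠ k := fun he => hc ⟨hA, hinj u hu hua he ▸ hu⟩
        omega
      · rw [idxOf_le_idxOf_insertAt hua hA hk] at h₁
        rwa [idxOf_le_idxOf_insertAt hua hA hk.le]

/-- The permutations of adjacent acyclic orientations. -/
def PermAdj (n : ℕ) (E : Finset (Finset ℕ)) (π σ : List ℕ) : Prop :=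
  ∃ h h' : AO E, (flipGraph E).Adj h h' ∧ π = perm n h.1 ∧ σ = perm n h'.1

theorem PermAdj.symm {π σ : List ℕ} (h : PermAdj n E π σ) : PermAdj n E σ π := by
  obtain ⟨h, h', hadj, h₁, h₂⟩ := h
  exact ⟨h', h, hadj.symm, h₂, h₁⟩

theorem flipGraph_adj_of_pairFlip {h h' : AO E} {i j : ℕ} (hf : h.1.PairFlip h'.1 i j) :
    (flipGraph E).Adj h h' := by
  rw [flipGraph, SimpleGraph.fromRel_adj]
  exact ⟨fun he => hf.2.1 (by rw [he]), Or.inl ⟨i, j, hf⟩⟩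

theorem IsChordalBuildingSet.consecutiveRelated (hE : IsChordalBuildingSet (n + 1) E)
    (h₀ : AO (inducedEdges E n)) :
    ConsecutiveRelated (permLanguage (n + 1) E) (PermAdj (n + 1) E) (n + 1) (perm n h₀.1) := by
  rintro p q hpq hq ⟨hp, hpe⟩ ⟨hq', hqe⟩ hnot
  obtain ⟨hπ, -⟩ := hE.induced.perm_spec h₀.2
  have hlen := length_of_perm hπ
  have ha := notMem_of_perm hπ
  generalize hρ : perm n h₀.1 = π at *
  have hrp : hp.1.Respects (insertAt (n + 1) π p) := hpe ▸ (hE.perm_spec hp.2).2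
  have hrq : hq'.1.Respects (insertAt (n + 1) π q) := hqe ▸ (hE.perm_spec hq'.2).2
  have huniq : ∀ (k : ℕ) (h h' : AO E), h.1.Respects (insertAt (n + 1) π k) →
      h'.1.Respects (insertAt (n + 1) π k) → h = h' := fun k h h' =>
    hE.respects_unique (insertAt_perm hπ k)
  have hne : hp ≠ hq' := by
    rintro rfl
    have := (insertAt_inj ha ha (by omega) hq (hpe.trans hqe.symm)).2
    omega
  -- Between `m` and `m + 1` the position leaves the interval of `hp`. The orientation `g`
  -- compatible with `m + 1` is shown to be `hq'`, so that one crossed entry accounts for the whole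
  -- jump.
  obtain ⟨m, hpm, hmq, hm, hm'⟩ : ∃ m, p ≤ m ∧ m < q ∧ hp.1.Respects (insertAt (n + 1) π m) ∧
      ¬ hp.1.Respects (insertAt (n + 1) π (m + 1)) := by
    by_contra! hcon
    have : ∀ m, p ≤ m → m ≤ q → hp.1.Respects (insertAt (n + 1) π m) := by
      intro m hm
      induction m, hm using Nat.le_induction with
      | base => exact fun _ => hrp
      | succ m hm ih => exact fun hmq => hcon m hm hmq (ih (by omega))
    exact hne (huniq q _ _ (this q hpq.le le_rfl) hrq)
  obtain ⟨g, hg⟩ := hE.exists_respects (insertAt_perm hπ (m + 1))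
  obtain ⟨r, hr, hgr, hgr'⟩ := hE.exists_perm_eq (k := m + 1) (h₀ := h₀) (by omega)
    (by rwa [hρ])
  rw [hρ] at hgr hgr'
  -- If the representative position `r` of `g` were at most `p`, the interval of `g` would contain
  -- `p`, whence `g = hp`, against `hm'`. Strictly between `p` and `q` there is no representative at
  -- all.
  have hrq' : q ≤ r := by
    by_contra! hlt
    rcases le_or_gt r p with hrp' | hrp'
    · have := respects_insertAt_of_between ha hrp' (by omega : p ≤ m + 1) (by omega) hgr' hg
      exact hm' (huniq p _ _ this hrp ▸ hg)
    · exact hnot r hrp' hlt ⟨g, hgr.symm⟩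
  obtain rfl : g = hq' := huniq q _ _
    (respects_insertAt_of_between ha (by omega : m + 1 ≤ q) hrq' (by omega) hg hgr') hrq
  have hflip := (eq_or_pairFlip_of_respects ha (hπ.nodup_iff.mpr List.nodup_range') (by omega)
    (fun A hA u hu => mem_insertAt.mp (hE.mem_of_perm (insertAt_perm hπ p) A hA u hu))
    hg hm).resolve_left fun he => hne (Subtype.ext he.symm)
  have hadj : PermAdj (n + 1) E (insertAt (n + 1) π q) (insertAt (n + 1) π p) :=
    ⟨g, hp, flipGraph_adj_of_pairFlip hflip, hqe, hpe⟩
  exact ⟨hadj.symm, hadj⟩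

/-! ### Orientations with the largest vertex at an end of the permutation -/

theorem isMaxVertex_of_forall {h : HyperOrientation E} {a : ℕ}
    (hA : ∀ A, a ∈ A.1 → h.head A = a) : h.IsMaxVertex a := by
  intro j hj
  obtain ⟨u, ⟨hne, A, haA, -, he⟩, -⟩ := Relation.TransGen.head'_iff.mp hj
  exact hne ((hA A haA).symm.trans he)

theorem isMinVertex_of_forall {h : HyperOrientation E} {a : ℕ}
    (hA : ∀ A, ∀ u ∈ A.1, u ≠ a → h.head A ≠ a) : h.IsMinVertex a := by
  intro j hj
  obtain ⟨u, -, ⟨hne, A, hu, -, he⟩⟩ := Relation.TransGen.tail'_iff.mp hj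
  exact hA A u hu hne he

theorem IsBuildingSet.head_eq_of_respects_concat (hE : IsBuildingSet (n + 1) E)
    {h : HyperOrientation E} {π : List ℕ} (hπ : π.Perm (List.range' 1 n))
    (hr : h.Respects (π ++ [n + 1])) (A : {A : Finset ℕ // A ∈ E}) (hA : n + 1 ∈ A.1) :
    h.head A = n + 1 := by
  rw [← insertAt_length] at hr
  have ha := notMem_of_perm hπ
  refine hr.head_eq (hE.mem_of_perm (insertAt_perm hπ _)) A hA fun u hu => ?_
  by_cases hun : u = n + 1
  · rw [hun]
  · rw [idxOf_le_idxOf_self_insertAt ha hun le_rfl]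
    refine List.idxOf_lt_length_iff.mpr ?_
    exact (mem_insertAt.mp (hE.mem_of_perm (insertAt_perm hπ 0) A.1 A.2 u hu)).resolve_left hun

theorem head_ne_of_respects_cons {h : HyperOrientation E} {a : ℕ} {π : List ℕ}
    (hr : h.Respects (a :: π)) (A : {A : Finset ℕ // A ∈ E}) {u : ℕ} (hu : u ∈ A.1)
    (hua : u ≠ a) : h.head A ≠ a := by
  intro he
  have := hr A u hu
  rw [he, List.idxOf_cons_ne _ hua.symm, List.idxOf_cons_self] at this
  omega

theorem IsChordalBuildingSet.perm_eq_concat (hE : IsChordalBuildingSet (n + 1) E)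
    {h : AO E} {h₀ : AO (inducedEdges E n)}
    (hr : h.1.Respects (perm n h₀.1 ++ [n + 1])) : perm (n + 1) h.1 = perm n h₀.1 ++ [n + 1] := by
  have hπ := (hE.induced.perm_spec h₀.2).1
  have he : h.restrict n = h₀ := hE.restrict_eq (k := n) le_rfl (by
    have := insertAt_length (n + 1) (perm n h₀.1)
    rw [length_of_perm hπ] at this
    rwa [this])
  rw [perm_succ_of_isMaxVertex
    (isMaxVertex_of_forall (hE.head_eq_of_respects_concat hπ hr)), ← he]
  rfl

/-- The hyperedge `A` gives `n + 1` an outgoing arc. Without it, `n + 1` would also be maximal, and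
`perm` would put it at the end. -/
theorem IsChordalBuildingSet.perm_eq_cons (hE : IsChordalBuildingSet (n + 1) E)
    {h : AO E} {h₀ : AO (inducedEdges E n)} {A : Finset ℕ} (hA : A ∈ E) (hnA : n + 1 ∈ A)
    {u : ℕ} (hu : u ∈ A) (hun : u ≠ n + 1)
    (hr : h.1.Respects ((n + 1) :: perm n h₀.1)) : perm (n + 1) h.1 = (n + 1) :: perm n h₀.1 := by
  have he : h.restrict n = h₀ := hE.restrict_eq (k := 0) (Nat.zero_le _) hr
  have hne := fun A u hu hun => head_ne_of_respects_cons hr A (u := u) hu hun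
  rw [perm_succ_of_isMinVertex _ (isMinVertex_of_forall hne), ← he]
  · rfl
  · intro hmax
    exact hmax _ (.single (h.1.arc_head ⟨A, hA⟩ hnA (Ne.symm (hne ⟨A, hA⟩ u hu hun))))

/-- A pair flip of the restrictions lifts if the largest vertex is maximal in both orientations, or
minimal in both. -/
theorem IsChordalBuildingSet.pairFlip_of_restrict (hE : IsChordalBuildingSet (n + 1) E)
    {h h' : AO E} {i j : ℕ} (hf : (h.restrict n).1.PairFlip (h'.restrict n).1 i j)
    (hc : (∀ A, n + 1 ∈ A.1 → h.1.head A = n + 1 ∧ h'.1.head A = n + 1) ∨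
      ∀ A, ∀ u ∈ A.1, u ≠ n + 1 → h.1.head A ≠ n + 1 ∧ h'.1.head A ≠ n + 1) :
    h.1.PairFlip h'.1 i j := by
  obtain ⟨hij, hne, hflip⟩ := hf
  have hlt : ∀ A : {A : Finset ℕ // A ∈ inducedEdges E n}, ∀ x ∈ A.1, x ≠ n + 1 := by
    intro A x hx
    have := Finset.mem_Icc.mp ((mem_inducedEdges.mp A.2).2 hx)
    omega
  -- No hyperedge in `[n]` involves `n + 1`, so a pair containing it would flip nothing, although
  -- the restrictions differ.
  have hijn : i ≠ n + 1 ∧ j ≠ n + 1 := by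
    by_contra hcon
    refine hne (HyperOrientation.ext (funext fun A => ?_))
    rw [hflip A, if_neg]
    rintro ⟨h₁, h₂⟩
    exact hcon ⟨hlt A i h₂, h₁ ▸ hlt A _ ((h.restrict n).1.head_mem A)⟩
  refine ⟨hij, fun he => hne ?_, fun A => ?_⟩
  · change h'.1.restrict n = h.1.restrict n
    rw [he]
  by_cases hnA : n + 1 ∈ A.1
  · by_cases hex : ∃ u ∈ A.1, u ≠ n + 1
    · rcases hc with hc | hc
      · rw [(hc A hnA).1, (hc A hnA).2, if_neg fun hc' => hijn.2 hc'.1.symm]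
      -- When `n + 1` is minimal in both orientations, erasing it preserves both heads, so the flip
      -- rule is inherited from the smaller hyperedge.
      · obtain ⟨u, hu, hun⟩ := hex
        obtain ⟨h₁, h₂⟩ := hc A u hu hun
        have := hflip ⟨A.1.erase (n + 1), hE.erase_mem_inducedEdges A.2 hu hun⟩
        rw [show (h.restrict n).1.head _ = _ from hE.head_restrict_erase h.2 h₁,
          show (h'.restrict n).1.head _ = _ from hE.head_restrict_erase h'.2 h₂] at this
        simpa [hijn.1] using this
    · push Not at hex
      rw [hex _ (h.1.head_mem A), hex _ (h'.1.head_mem A), if_neg fun hc' => hijn.2 hc'.1.symm]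
  · exact hflip ⟨A.1, mem_inducedEdges.mpr ⟨A.2, hE.subset_of_notMem A.2 hnA⟩⟩

theorem IsChordalBuildingSet.permAdj_of_restrict (hE : IsChordalBuildingSet (n + 1) E)
    {h h' : AO E} (hadj : (flipGraph (inducedEdges E n)).Adj (h.restrict n) (h'.restrict n))
    (hc : (∀ A, n + 1 ∈ A.1 → h.1.head A = n + 1 ∧ h'.1.head A = n + 1) ∨
      ∀ A, ∀ u ∈ A.1, u ≠ n + 1 → h.1.head A ≠ n + 1 ∧ h'.1.head A ≠ n + 1) :
    PermAdj (n + 1) E (perm (n + 1) h.1) (perm (n + 1) h'.1) := by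
  rw [flipGraph, SimpleGraph.fromRel_adj] at hadj
  obtain ⟨-, ⟨i, j, hf⟩ | ⟨i, j, hf⟩⟩ := hadj
  · exact ⟨h, h', flipGraph_adj_of_pairFlip (hE.pairFlip_of_restrict hf hc), rfl, rfl⟩
  · have hc' : (∀ A, n + 1 ∈ A.1 → h'.1.head A = n + 1 ∧ h.1.head A = n + 1) ∨
        ∀ A, ∀ u ∈ A.1, u ≠ n + 1 → h'.1.head A ≠ n + 1 ∧ h.1.head A ≠ n + 1 := by
      simpa only [and_comm] using hc
    exact ⟨h, h', (flipGraph_adj_of_pairFlip (hE.pairFlip_of_restrict hf hc')).symm, rfl, rfl⟩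

theorem IsChordalBuildingSet.lt_of_mem_permLanguage (hE : IsChordalBuildingSet n E) {π : List ℕ}
    (hπ : π ∈ permLanguage n E) : ∀ x ∈ π, x < n + 1 := by
  obtain ⟨h, rfl⟩ := hπ
  intro x hx
  rw [(hE.perm_spec h.2).1.mem_iff, mem_range'_one, Finset.mem_Icc] at hx
  omega

theorem IsChordalBuildingSet.exists_respects_concat (hE : IsChordalBuildingSet (n + 1) E)
    (h₀ : AO (inducedEdges E n)) : ∃ h : AO E, h.1.Respects (perm n h₀.1 ++ [n + 1]) := by
  rw [← insertAt_length]
  exact hE.exists_respects (insertAt_perm (hE.induced.perm_spec h₀.2).1 _)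

theorem IsChordalBuildingSet.restrict_of_respects_concat (hE : IsChordalBuildingSet (n + 1) E)
    {h : AO E} {h₀ : AO (inducedEdges E n)} (hr : h.1.Respects (perm n h₀.1 ++ [n + 1])) :
    h.restrict n = h₀ := by
  rw [← insertAt_length] at hr
  exact hE.restrict_eq (length_of_perm (hE.induced.perm_spec h₀.2).1).le hr

theorem IsChordalBuildingSet.permAdj_concat (hE : IsChordalBuildingSet (n + 1) E) (π σ : List ℕ)
    (hadj : PermAdj n (inducedEdges E n) π σ) :
    PermAdj (n + 1) E (π ++ [n + 1]) (σ ++ [n + 1]) := by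
  obtain ⟨h₀, h₀', hadj, rfl, rfl⟩ := hadj
  obtain ⟨h, hr⟩ := hE.exists_respects_concat h₀
  obtain ⟨h', hr'⟩ := hE.exists_respects_concat h₀'
  rw [← hE.perm_eq_concat hr, ← hE.perm_eq_concat hr']
  refine hE.permAdj_of_restrict ?_ (Or.inl fun A hA => ⟨?_, ?_⟩)
  · rwa [hE.restrict_of_respects_concat hr, hE.restrict_of_respects_concat hr']
  · exact hE.head_eq_of_respects_concat (hE.induced.perm_spec h₀.2).1 hr A hA
  · exact hE.head_eq_of_respects_concat (hE.induced.perm_spec h₀'.2).1 hr' A hA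

theorem IsChordalBuildingSet.concat_mem (hE : IsChordalBuildingSet (n + 1) E) {π : List ℕ}
    (hπ : π ∈ permLanguage n (inducedEdges E n)) : π ++ [n + 1] ∈ permLanguage (n + 1) E := by
  obtain ⟨h₀, rfl⟩ := hπ
  obtain ⟨h, hr⟩ := hE.exists_respects_concat h₀
  exact ⟨h, (hE.perm_eq_concat hr).symm⟩

/-! ### The two kinds of extension, and the induction -/

theorem IsChordalBuildingSet.trivialExtension (hE : IsChordalBuildingSet (n + 1) E)
    (hiso : ∀ A ∈ E, n + 1 ∈ A → ∀ u ∈ A, u = n + 1) :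
    TrivialExtension (permLanguage n (inducedEdges E n)) (permLanguage (n + 1) E)
      (PermAdj n (inducedEdges E n)) (PermAdj (n + 1) E) (n + 1) where
  lt _ := hE.induced.lt_of_mem_permLanguage
  mem_iff σ := by
    constructor
    · rintro ⟨h, rfl⟩
      exact ⟨_, ⟨h.restrict n, rfl⟩, perm_succ_of_isMaxVertex
        (isMaxVertex_of_forall fun A hA => hiso A.1 A.2 hA _ (h.1.head_mem A))⟩
    · rintro ⟨π, hπ, rfl⟩
      exact hE.concat_mem hπ
  rel_concat := hE.permAdj_concat

theorem IsChordalBuildingSet.zigzagExtension (hE : IsChordalBuildingSet (n + 1) E)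
    {A : Finset ℕ} (hA : A ∈ E) (hnA : n + 1 ∈ A) {u : ℕ} (hu : u ∈ A) (hun : u ≠ n + 1) :
    ZigzagExtension (permLanguage n (inducedEdges E n)) (permLanguage (n + 1) E)
      (PermAdj n (inducedEdges E n)) (PermAdj (n + 1) E) (n + 1) := by
  have hcons : ∀ h₀ : AO (inducedEdges E n), ∃ h : AO E,
      h.1.Respects ((n + 1) :: perm n h₀.1) := fun h₀ =>
    hE.exists_respects (insertAt_perm (hE.induced.perm_spec h₀.2).1 0)
  refine ⟨fun _ => hE.induced.lt_of_mem_permLanguage, ?_, ?_, fun _ => hE.concat_mem, ?_,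
    hE.permAdj_concat, ?_⟩
  · rintro _ ⟨h, rfl⟩
    obtain ⟨hπ, hr⟩ := hE.induced.perm_spec (h.restrict n).2
    obtain ⟨k, hk, he, -⟩ := hE.perm_succ h.2 hπ hr
    exact ⟨_, ⟨h.restrict n, rfl⟩, k, hk.trans (length_of_perm hπ).ge, he⟩
  · rintro _ ⟨h₀, rfl⟩
    obtain ⟨h, hr⟩ := hcons h₀
    exact ⟨h, (hE.perm_eq_cons hA hnA hu hun hr).symm⟩
  · rintro _ _ ⟨h₀, h₀', hadj, rfl, rfl⟩
    obtain ⟨h, hr⟩ := hcons h₀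
    obtain ⟨h', hr'⟩ := hcons h₀'
    rw [← hE.perm_eq_cons hA hnA hu hun hr, ← hE.perm_eq_cons hA hnA hu hun hr']
    refine hE.permAdj_of_restrict ?_ (Or.inr fun A u hu hun =>
      ⟨head_ne_of_respects_cons hr A hu hun, head_ne_of_respects_cons hr' A hu hun⟩)
    rwa [hE.restrict_eq (k := 0) (Nat.zero_le _) hr, hE.restrict_eq (k := 0) (Nat.zero_le _) hr']
  · rintro _ ⟨h₀, rfl⟩
    exact hE.consecutiveRelated h₀

theorem idPerm_succ (n : ℕ) : idPerm (n + 1) = idPerm n ++ [n + 1] := by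
  rw [idPerm, List.range'_1_concat, add_comm 1 n]
  rfl

/-- Algorithm J generates the permutations of all acyclic orientations along the flip graph. -/
theorem IsChordalBuildingSet.exists_isGrayRun (hE : IsChordalBuildingSet n E) :
    idPerm n ∈ permLanguage n E ∧
      ∃ out, IsGrayRun (permLanguage n E) (PermAdj n E) (idPerm n) out := by
  induction n generalizing E with
  | zero =>
    obtain ⟨h, -⟩ := hE.exists_respects (π := []) .nil
    have hmem : ∀ π, π ∈ permLanguage 0 E ↔ π = [] := fun π =>
      ⟨fun ⟨h, he⟩ => he, fun he => ⟨h, he⟩⟩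
    refine ⟨(hmem _).mpr rfl, [[]], .init, fun π => by rw [hmem, List.mem_singleton], ?_⟩
    intro π _ σ hs
    exact hs.notMem (by simpa using (hmem σ).mp hs.mem)
  | succ n ih =>
    obtain ⟨hid, out, hrun⟩ := ih hE.induced
    rw [idPerm_succ]
    refine ⟨hE.concat_mem hid, ?_⟩
    -- If `{n + 1}` is the only hyperedge containing `n + 1`, this vertex is always maximal and
    -- never moves; otherwise both ends are available.
    by_cases hiso : ∀ A ∈ E, n + 1 ∈ A → ∀ u ∈ A, u = n + 1
    · exact ⟨_, (hE.trivialExtension hiso).isGrayRun hid hrun⟩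
    · push Not at hiso
      obtain ⟨A, hA, hnA, u, hu, hun⟩ := hiso
      exact (hE.zigzagExtension hA hnA hu hun).exists_isGrayRun hid hrun

end

/-! ### Weights of orientations -/

section

variable {n : ℕ} {E : Finset (Finset ℕ)}

theorem IsBuildingSet.head_mem_Icc (hE : IsBuildingSet n E) (h : HyperOrientation E)
    (A : {A : Finset ℕ // A ∈ E}) : h.head A ∈ Finset.Icc 1 n :=
  hE.subset A.1 A.2 (h.head_mem A)

open Classical in
/-- An acyclic orientation has a weight function that is increasing along all arcs. -/
theorem IsBuildingSet.exists_weight (hE : IsBuildingSet n E) {h : HyperOrientation E}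
    (hh : h.IsAcyclic) :
    ∃ w : ℕ → ℝ, ∀ A, ∀ u ∈ A.1, u ≠ h.head A → w u < w (h.head A) := by
  -- The weight of `v` is the size of its principal down-set.
  let D (v : ℕ) : Finset ℕ :=
    (Finset.Icc 1 n).filter fun x => Relation.ReflTransGen h.Arc x v
  refine ⟨fun v => ((D v).card : ℝ), fun A u hu hne => ?_⟩
  have harc := h.arc_head A hu hne
  have hlt : (D u).card < (D (h.head A)).card := by
    refine Finset.card_lt_card ⟨fun x hx => ?_, fun hsub => ?_⟩
    · simp only [D, Finset.mem_filter] at hx ⊢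
      exact ⟨hx.1, hx.2.tail harc⟩
    · have : h.head A ∈ D u := hsub (Finset.mem_filter.mpr ⟨hE.head_mem_Icc h A, .refl⟩)
      simp only [D, Finset.mem_filter] at this
      exact hh _ (Relation.TransGen.head'_iff.mpr ⟨_, harc, this.2⟩)
  exact Nat.cast_lt.mpr hlt

theorem HyperOrientation.PairFlip.exists_flipped {h h' : HyperOrientation E} {i j : ℕ} (hf : h.PairFlip h' i j) :
    ∃ A, h.head A = j ∧ i ∈ A.1 ∧ h'.head A = i := by
  by_contra! hcon
  refine hf.2.1 (HyperOrientation.ext (funext fun A => ?_))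
  have := hf.2.2 A
  split_ifs at this with hc
  · exact absurd this (hcon A hc.1 hc.2)
  · exact this

/-- The pair of a flip between acyclic orientations is a cover. -/
theorem HyperOrientation.PairFlip.not_between {h h' : HyperOrientation E} {i j : ℕ} (hf : h.PairFlip h' i j)
    (hh : h.IsAcyclic) (hh' : h'.IsAcyclic) {k : ℕ} (hik : h.Below i k) (hkj : h.Below k j) :
    False := by
  obtain ⟨m, hkm, hmj⟩ := Relation.TransGen.tail'_iff.mp hkj
  have him : h.Below i m := hik.trans_left hkm
  -- Hyperedges with a head other than `j` are not changed by the flip, so a path from `i` to some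
  -- `m` below `j` survives in `h'`.
  have key : ∀ m, h.Below i m → h.Below m j → h'.Below i m := by
    have harc : ∀ a b, h.Arc a b → h.Below b j → h'.Arc a b := by
      rintro a b ⟨hne, A, ha, hb, he⟩ hbj
      refine ⟨hne, A, ha, hb, ?_⟩
      rw [hf.2.2 A, if_neg]
      · exact he
      · rintro ⟨rfl, -⟩
        exact hh _ (he ▸ hbj)
    intro m him
    induction him with
    | single hib => exact fun hbj => .single (harc _ _ hib hbj)
    | tail _ hbc ih => exact fun hcj => .tail (ih (.head hbc hcj)) (harc _ _ hbc hcj)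
  have him' := key m him (.single hmj)
  obtain ⟨hne, A, hmA, hjA, he⟩ := hmj
  have hA := hf.2.2 A
  -- The last arc `m → j` either turns into `m → i`, closing a cycle in `h'`, or survives and is
  -- followed by the flipped arc `j → i`.
  by_cases hiA : i ∈ A.1
  · rw [if_pos ⟨he, hiA⟩] at hA
    exact hh' i (him'.tail ⟨fun h' => hh i (by rwa [h'] at him), A, hmA, hiA, hA⟩)
  · rw [if_neg fun hc => hiA hc.2, he] at hA
    obtain ⟨B, hB, hiB, hB'⟩ := hf.exists_flipped
    exact hh' i ((him'.tail ⟨hne, A, hmA, hjA, hA⟩).tail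
      ⟨hf.1.symm, B, hB ▸ h.head_mem B, hiB, hB'⟩)

open Classical in
/-- For a flip between acyclic orientations there is a weight function that is increasing along all
arcs, except that it is constant on the flipped pair. -/
theorem IsBuildingSet.exists_weight_of_pairFlip (hE : IsBuildingSet n E)
    {h h' : HyperOrientation E} {i j : ℕ} (hf : h.PairFlip h' i j) (hh : h.IsAcyclic)
    (hh' : h'.IsAcyclic) :
    ∃ w : ℕ → ℝ, w i = w j ∧
      ∀ A, ∀ u ∈ A.1, u ≠ h.head A → ¬ (h.head A = j ∧ u = i) → w u < w (h.head A) := by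
  -- This is the down-set of `v` in the preorder generated by the arcs and the reversed relation
  -- from `j` to `i`, which identifies `i` with `j`.
  let D (v : ℕ) : Finset ℕ := (Finset.Icc 1 n).filter fun x => Relation.ReflTransGen h.Arc x v ∨
    (Relation.ReflTransGen h.Arc i v ∧ Relation.ReflTransGen h.Arc x j)
  have hij : h.Arc i j := by
    obtain ⟨A, hA, hiA, -⟩ := hf.exists_flipped
    exact ⟨hf.1, A, hiA, hA ▸ h.head_mem A, hA⟩
  refine ⟨fun v => ((D v).card : ℝ), ?_, fun A u hu hne hc => ?_⟩
  · have : D i = D j := by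
      refine Finset.filter_congr fun x _ => ?_
      constructor
      · rintro (hx | hx)
        · exact Or.inl (hx.tail hij)
        · exact Or.inl hx.2
      · rintro (hx | hx)
        · exact Or.inr ⟨.refl, hx⟩
        · exact Or.inr ⟨.refl, hx.2⟩
    simp only [this]
  have harc := h.arc_head A hu hne
  have hlt : (D u).card < (D (h.head A)).card := by
    refine Finset.card_lt_card ⟨fun x hx => ?_, fun hsub => ?_⟩
    · simp only [D, Finset.mem_filter] at hx ⊢
      exact ⟨hx.1, hx.2.imp (·.tail harc) fun hx => ⟨hx.1.tail harc, hx.2⟩⟩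
    · have : h.head A ∈ D u := hsub (Finset.mem_filter.mpr ⟨hE.head_mem_Icc h A, .inl .refl⟩)
      simp only [D, Finset.mem_filter] at this
      -- A head in the down-set of `u` gives a cycle of `h`, or else `u` and the head both lie
      -- weakly between `i` and `j`. The pair `(i, j)` itself is excluded, and nothing lies strictly
      -- between.
      rcases this.2 with hx | ⟨h₁, h₂⟩
      · exact hh _ (Relation.TransGen.head'_iff.mpr ⟨_, harc, hx⟩)
      · rcases Relation.reflTransGen_iff_eq_or_transGen.mp h₁ with h₃ | h₃
        · rcases Relation.reflTransGen_iff_eq_or_transGen.mp h₂ with h₄ | h₄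
          · exact hc ⟨h₄.symm, h₃⟩
          · exact hf.not_between hh hh' (h₃ ▸ .single harc) h₄
        · exact hf.not_between hh hh' h₃ (Relation.TransGen.head'_iff.mpr ⟨_, harc, h₂⟩)
  exact Nat.cast_lt.mpr hlt

/-! ### Points of the hypergraphic polytope -/

/-- The unit vector of `v` in `ℝⁿ`. -/
def unitVec (n v : ℕ) : Space n := fun i => if i.1 = v then 1 else 0

theorem unitVec_apply {v : ℕ} (i : {i : ℕ // i ∈ Finset.Icc 1 n}) :
    unitVec n v i = if i.1 = v then 1 else 0 := rfl

theorem unitVec_eq_single {v : ℕ} (hv : v ∈ Finset.Icc 1 n) :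
    unitVec n v = Pi.single (⟨v, hv⟩ : {i : ℕ // i ∈ Finset.Icc 1 n}) 1 := by
  ext i
  simp [unitVec, Pi.single_apply, Subtype.ext_iff]

theorem unitVec_mem_simplex {v : ℕ} (hv : v ∈ Finset.Icc 1 n) {A : Finset ℕ} (hA : v ∈ A) :
    unitVec n v ∈ simplex n A :=
  subset_convexHull ℝ _ ⟨⟨v, hv⟩, hA, unitVec_eq_single hv⟩

theorem eq_sum_unitVec (z : Space n) : z = ∑ i, z i • unitVec n i.1 := by
  ext k
  simp [unitVec_apply, Finset.sum_apply]

theorem simplex_subset (A : Finset ℕ) {z : Space n} (hz : z ∈ simplex n A) :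
    (∀ i, 0 ≤ z i) ∧ ∑ i, z i = 1 ∧ ∀ i, i.1 ∉ A → z i = 0 := by
  have hconv : Convex ℝ {z : Space n | (∀ i, 0 ≤ z i) ∧ ∑ i, z i = 1 ∧ ∀ i, i.1 ∉ A → z i = 0} := by
    rintro x ⟨hx₁, hx₂, hx₃⟩ y ⟨hy₁, hy₂, hy₃⟩ s t hs ht hst
    refine ⟨fun i => ?_, ?_, fun i hi => ?_⟩
    · exact add_nonneg (mul_nonneg hs (hx₁ i)) (mul_nonneg ht (hy₁ i))
    · simp only [Pi.add_apply, Pi.smul_apply, smul_eq_mul, Finset.sum_add_distrib,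
        ← Finset.mul_sum, hx₂, hy₂, mul_one, hst]
    · simp [hx₃ i hi, hy₃ i hi]
  refine convexHull_min ?_ hconv hz
  rintro _ ⟨v, hv, rfl⟩
  refine ⟨fun i => ?_, by simp, fun i hi => ?_⟩
  · rw [Pi.single_apply]
    split_ifs <;> norm_num
  · rw [Pi.single_apply, if_neg]
    rintro rfl
    exact hi hv

/-- The coordinates of `z` sum to 1, so the defect of `z` is the weighted average of the defects of
the unit vectors. Nonnegative summands then yield both the bound and the support of a maximizer. -/
theorem sub_apply_eq_sum (l : Space n →L[ℝ] ℝ) (c : ℝ) {A : Finset ℕ} {z : Space n}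
    (hz : z ∈ simplex n A) : c - l z = ∑ i, z i * (c - l (unitVec n i.1)) := by
  conv_lhs => rw [eq_sum_unitVec z]
  simp only [map_sum, map_smul, smul_eq_mul, mul_sub, Finset.sum_sub_distrib, ← Finset.sum_mul,
    (simplex_subset A hz).2.1, one_mul]

theorem mul_sub_nonneg_of_mem_simplex {l : Space n →L[ℝ] ℝ} {c : ℝ} {A : Finset ℕ}
    (hmax : ∀ u ∈ A, l (unitVec n u) ≤ c) {z : Space n} (hz : z ∈ simplex n A)
    (i : {i : ℕ // i ∈ Finset.Icc 1 n}) : 0 ≤ z i * (c - l (unitVec n i.1)) := by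
  obtain ⟨h₁, -, h₃⟩ := simplex_subset A hz
  by_cases hi : i.1 ∈ A
  · exact mul_nonneg (h₁ i) (sub_nonneg.mpr (hmax _ hi))
  · rw [h₃ i hi, zero_mul]

theorem apply_le_of_mem_simplex {l : Space n →L[ℝ] ℝ} {c : ℝ} {A : Finset ℕ}
    (hmax : ∀ u ∈ A, l (unitVec n u) ≤ c) {z : Space n} (hz : z ∈ simplex n A) : l z ≤ c := by
  rw [← sub_nonneg, sub_apply_eq_sum l c hz]
  exact Finset.sum_nonneg fun i _ => mul_sub_nonneg_of_mem_simplex hmax hz i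

/-- A maximizer of a functional on a simplex is supported on the maximal vertices. -/
theorem eq_zero_of_mem_simplex {l : Space n →L[ℝ] ℝ} {c : ℝ} {A : Finset ℕ}
    (hmax : ∀ u ∈ A, l (unitVec n u) ≤ c) {z : Space n} (hz : z ∈ simplex n A) (hl : l z = c)
    (i : {i : ℕ // i ∈ Finset.Icc 1 n}) (hi : i.1 ∈ A → l (unitVec n i.1) < c) : z i = 0 := by
  by_cases hiA : i.1 ∈ A
  · have hsum := sub_apply_eq_sum l c hz
    rw [hl, sub_self, eq_comm, Finset.sum_eq_zero_iff_of_nonneg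
      fun i _ => mul_sub_nonneg_of_mem_simplex hmax hz i] at hsum
    exact (mul_eq_zero.mp (hsum i (Finset.mem_univ i))).resolve_right (sub_pos.mpr (hi hiA)).ne'
  · exact (simplex_subset A hz).2.2 i hiA

theorem eq_unitVec_of_mem_simplex {A : Finset ℕ} {z : Space n} (hz : z ∈ simplex n A)
    {v : ℕ} (hv : v ∈ Finset.Icc 1 n) (h : ∀ i, i.1 ≠ v → z i = 0) : z = unitVec n v := by
  have hsum := (simplex_subset A hz).2.1
  rw [Fintype.sum_eq_single (⟨v, hv⟩ : {i : ℕ // i ∈ Finset.Icc 1 n})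
    fun i hi => h i fun he => hi (Subtype.ext he)] at hsum
  ext i
  rw [unitVec_apply]
  split_ifs with hi
  · rw [← hsum]
    exact congrArg z (Subtype.ext hi)
  · exact h i hi

theorem eq_unitVec_add_of_mem_simplex {A : Finset ℕ} {z : Space n} (hz : z ∈ simplex n A)
    {i j : {i : ℕ // i ∈ Finset.Icc 1 n}} (hij : i ≠ j) (h : ∀ k, k ≠ i → k ≠ j → z k = 0) :
    z = unitVec n j.1 + z i • (unitVec n i.1 - unitVec n j.1) := by
  have hsum := (simplex_subset A hz).2.1
  rw [Fintype.sum_eq_add i j hij fun k hk => h k hk.1 hk.2] at hsum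
  ext k
  simp only [Pi.add_apply, Pi.smul_apply, Pi.sub_apply, unitVec_apply, ← Subtype.ext_iff,
    smul_eq_mul]
  by_cases hki : k = i
  · subst hki
    simp [hij]
  · by_cases hkj : k = j
    · subst hkj
      simp [hki]
      linarith
    · simp [hki, hkj, h k hki hkj]

theorem inDegreeSeq_eq_sum (h : HyperOrientation E) :
    inDegreeSeq n h = ∑ A, unitVec n (h.head A) := by
  ext i
  simp [inDegreeSeq, Finset.sum_apply, unitVec_apply, eq_comm]

theorem mem_hypergraphicPolytope {z : Space n} :
    z ∈ hypergraphicPolytope n E ↔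
      ∃ g : {A : Finset ℕ // A ∈ E} → Space n, (∀ A, g A ∈ simplex n A.1) ∧ z = ∑ A, g A := by
  rw [hypergraphicPolytope, ← Finset.sum_coe_sort, Set.mem_finsetSum]
  constructor
  · rintro ⟨g, hg, rfl⟩
    exact ⟨g, fun A => hg (Finset.mem_univ A), rfl⟩
  · rintro ⟨g, hg, rfl⟩
    exact ⟨g, fun {A} _ => hg A, rfl⟩

theorem convex_hypergraphicPolytope : Convex ℝ (hypergraphicPolytope n E) := by
  intro x hx y hy s t hs ht hst
  rw [mem_hypergraphicPolytope] at *
  obtain ⟨f, hf, rfl⟩ := hx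
  obtain ⟨g, hg, rfl⟩ := hy
  exact ⟨fun A => s • f A + t • g A, fun A => convex_convexHull ℝ _ (hf A) (hg A) hs ht hst,
    by simp only [Finset.sum_add_distrib, Finset.smul_sum]⟩

theorem IsBuildingSet.inDegreeSeq_mem (hE : IsBuildingSet n E) (h : HyperOrientation E) :
    inDegreeSeq n h ∈ hypergraphicPolytope n E :=
  mem_hypergraphicPolytope.mpr ⟨_, fun A =>
    unitVec_mem_simplex (hE.head_mem_Icc h A) (h.head_mem A), inDegreeSeq_eq_sum h⟩

theorem apply_inDegreeSeq (l : Space n →L[ℝ] ℝ) (h : HyperOrientation E) :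
    l (inDegreeSeq n h) = ∑ A, l (unitVec n (h.head A)) := by
  rw [inDegreeSeq_eq_sum, map_sum]

/-- An orientation to vertices of maximal weight maximizes the functional on the polytope. -/
theorem apply_le_apply_inDegreeSeq {l : Space n →L[ℝ] ℝ} {h : HyperOrientation E}
    (hmax : ∀ A, ∀ u ∈ A.1, l (unitVec n u) ≤ l (unitVec n (h.head A))) {z : Space n}
    (hz : z ∈ hypergraphicPolytope n E) : l z ≤ l (inDegreeSeq n h) := by
  obtain ⟨g, hg, rfl⟩ := mem_hypergraphicPolytope.mp hz
  rw [apply_inDegreeSeq, map_sum]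
  exact Finset.sum_le_sum fun A _ => apply_le_of_mem_simplex (hmax A) (hg A)

theorem apply_eq_of_maximal {l : Space n →L[ℝ] ℝ} {h : HyperOrientation E}
    (hmax : ∀ A, ∀ u ∈ A.1, l (unitVec n u) ≤ l (unitVec n (h.head A)))
    {g : {A : Finset ℕ // A ∈ E} → Space n} (hg : ∀ A, g A ∈ simplex n A.1)
    (hz : l (inDegreeSeq n h) ≤ l (∑ A, g A)) (A : {A : Finset ℕ // A ∈ E}) :
    l (g A) = l (unitVec n (h.head A)) := by
  have hle : ∀ A ∈ Finset.univ, l (g A) ≤ l (unitVec n (h.head A)) :=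
    fun A _ => apply_le_of_mem_simplex (hmax A) (hg A)
  rw [apply_inDegreeSeq, map_sum] at hz
  exact (Finset.sum_eq_sum_iff_of_le hle).mp (le_antisymm (Finset.sum_le_sum hle) hz) A
    (Finset.mem_univ A)

/-! ### Vertices of the hypergraphic polytope -/

/-- The functional with given values on the unit vectors. -/
noncomputable def weightFunctional (n : ℕ) (w : ℕ → ℝ) : Space n →L[ℝ] ℝ :=
  ∑ i : {i : ℕ // i ∈ Finset.Icc 1 n}, w i.1 • ContinuousLinearMap.proj i

theorem weightFunctional_unitVec (w : ℕ → ℝ) {v : ℕ} (hv : v ∈ Finset.Icc 1 n) :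
    weightFunctional n w (unitVec n v) = w v := by
  rw [unitVec_eq_single hv]
  simp [weightFunctional, Pi.single_apply]

/-- If the heads have strictly largest weight, then the in-degree sequence is the unique maximizer
of the functional. -/
theorem IsBuildingSet.eq_of_maximal (hE : IsBuildingSet n E) {l : Space n →L[ℝ] ℝ}
    {h : HyperOrientation E} (hmax : ∀ A, ∀ u ∈ A.1, u ≠ h.head A →
      l (unitVec n u) < l (unitVec n (h.head A)))
    {g : {A : Finset ℕ // A ∈ E} → Space n} (hg : ∀ A, g A ∈ simplex n A.1)
    (hz : l (inDegreeSeq n h) ≤ l (∑ A, g A)) (A : {A : Finset ℕ // A ∈ E}) :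
    g A = unitVec n (h.head A) := by
  have hmax' : ∀ A, ∀ u ∈ A.1, l (unitVec n u) ≤ l (unitVec n (h.head A)) := by
    intro A u hu
    by_cases hne : u = h.head A
    · rw [hne]
    · exact (hmax A u hu hne).le
  exact eq_unitVec_of_mem_simplex (hg A) (hE.head_mem_Icc h A) fun i hi =>
    eq_zero_of_mem_simplex (hmax' A) (hg A) (apply_eq_of_maximal hmax' hg hz A) i
      fun hiA => hmax A i.1 hiA hi

theorem IsBuildingSet.exists_functional (hE : IsBuildingSet n E) {h : HyperOrientation E}
    (hh : h.IsAcyclic) : ∃ l : Space n →L[ℝ] ℝ, ∀ A, ∀ u ∈ A.1, u ≠ h.head A →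
      l (unitVec n u) < l (unitVec n (h.head A)) := by
  obtain ⟨w, hw⟩ := hE.exists_weight hh
  refine ⟨weightFunctional n w, fun A u hu hne => ?_⟩
  rw [weightFunctional_unitVec w (hE.subset A.1 A.2 hu),
    weightFunctional_unitVec w (hE.head_mem_Icc h A)]
  exact hw A u hu hne

theorem IsBuildingSet.inDegreeSeq_mem_exposedPoints (hE : IsBuildingSet n E)
    {h : HyperOrientation E} (hh : h.IsAcyclic) :
    inDegreeSeq n h ∈ (hypergraphicPolytope n E).exposedPoints ℝ := by
  obtain ⟨l, hl⟩ := hE.exists_functional hh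
  refine ⟨hE.inDegreeSeq_mem h, l, fun y hy => ⟨apply_le_apply_inDegreeSeq ?_ hy, fun hle => ?_⟩⟩
  · intro A u hu
    by_cases hne : u = h.head A
    · rw [hne]
    · exact (hl A u hu hne).le
  · obtain ⟨g, hg, rfl⟩ := mem_hypergraphicPolytope.mp hy
    rw [inDegreeSeq_eq_sum]
    exact Finset.sum_congr rfl fun A _ => hE.eq_of_maximal hl hg hle A

theorem unitVec_injOn {u v : ℕ} (hu : u ∈ Finset.Icc 1 n) (h : unitVec n u = unitVec n v) :
    u = v := by
  by_contra hne
  have := congrFun h ⟨u, hu⟩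
  simp [unitVec_apply, hne] at this

theorem IsBuildingSet.inDegreeSeq_injective (hE : IsBuildingSet n E) {h h' : HyperOrientation E}
    (hh : h.IsAcyclic) (he : inDegreeSeq n h = inDegreeSeq n h') : h = h' := by
  obtain ⟨l, hl⟩ := hE.exists_functional hh
  ext A
  refine (unitVec_injOn (hE.head_mem_Icc h' A) (hE.eq_of_maximal hl
    (g := fun A => unitVec n (h'.head A)) (fun A => unitVec_mem_simplex (hE.head_mem_Icc h' A)
      (h'.head_mem A)) ?_ A)).symm
  rw [he, inDegreeSeq_eq_sum h']

open Classical in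
/-- The orientation that arises from `h` by changing the head of one hyperedge. -/
def updateHead (h : HyperOrientation E) (A : {A : Finset ℕ // A ∈ E}) {u : ℕ}
    (hu : u ∈ A.1) : HyperOrientation E where
  head B := if B = A then u else h.head B
  head_mem B := by
    split_ifs with hB
    · rwa [hB]
    · exact h.head_mem B

theorem inDegreeSeq_updateHead (h : HyperOrientation E) (A : {A : Finset ℕ // A ∈ E}) {u : ℕ}
    (hu : u ∈ A.1) : inDegreeSeq n (updateHead h A hu) =
      inDegreeSeq n h + (unitVec n u - unitVec n (h.head A)) := by
  classical
  rw [← sub_eq_iff_eq_add', inDegreeSeq_eq_sum, inDegreeSeq_eq_sum, ← Finset.sum_sub_distrib,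
    Finset.sum_eq_single A]
  · simp [updateHead]
  · intro B _ hB
    simp [updateHead, hB]
  · simp

/-- Choosing heads of maximal value under the exposing functional reproduces `x`. Uniqueness of the
maximizer rules out ties, so the functional strictly increases along arcs, and no cycle exists. -/
theorem IsBuildingSet.exists_of_mem_exposedPoints (hE : IsBuildingSet n E) {x : Space n}
    (hx : x ∈ (hypergraphicPolytope n E).exposedPoints ℝ) :
    ∃ h : AO E, inDegreeSeq n h.1 = x := by
  obtain ⟨hxZ, l, hl⟩ := hx
  have key : ∀ A : {A : Finset ℕ // A ∈ E}, ∃ v ∈ A.1, ∀ u ∈ A.1,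
      l (unitVec n u) ≤ l (unitVec n v) := fun A => A.1.exists_max_image _ (hE.nonempty A.1 A.2)
  choose f hf hmax using key
  let h : HyperOrientation E := ⟨f, hf⟩
  have hhx : inDegreeSeq n h = x :=
    (hl _ (hE.inDegreeSeq_mem h)).2 (apply_le_apply_inDegreeSeq hmax hxZ)
  have hlt : ∀ A : {A : Finset ℕ // A ∈ E}, ∀ u ∈ A.1, u ≠ h.head A →
      l (unitVec n u) < l (unitVec n (h.head A)) := by
    intro A u hu hne
    -- A tie would allow the head of `A` to be replaced by `u`, which gives a second maximizer.
    refine lt_of_le_of_ne (hmax A u hu) fun he => hne ?_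
    have := (hl _ (hE.inDegreeSeq_mem (updateHead h A hu))).2 (by
      rw [inDegreeSeq_updateHead, hhx, map_add, map_sub, he, sub_self, add_zero])
    rw [inDegreeSeq_updateHead, hhx, add_eq_left, sub_eq_zero] at this
    exact unitVec_injOn (hE.subset A.1 A.2 hu) this
  refine ⟨⟨h, fun i hi => ?_⟩, hhx⟩
  have hmono : ∀ i j, h.Below i j → l (unitVec n i) < l (unitVec n j) := by
    have harc : ∀ i j, h.Arc i j → l (unitVec n i) < l (unitVec n j) := by
      rintro i j ⟨hne, A, hi, -, rfl⟩
      exact hlt A i hi hne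
    intro i j hij
    induction hij with
    | single hij => exact harc _ _ hij
    | tail _ hij ih => exact ih.trans (harc _ _ hij)
  exact lt_irrefl _ (hmono i i hi)

/-! ### Edges of the hypergraphic polytope -/

theorem HyperOrientation.PairFlip.unitVec_head {h h' : HyperOrientation E} {i j : ℕ} (hf : h.PairFlip h' i j)
    (A : {A : Finset ℕ // A ∈ E}) [Decidable (h.head A = j ∧ i ∈ A.1)] :
    unitVec n (h'.head A) = unitVec n (h.head A) +
      (if h.head A = j ∧ i ∈ A.1 then (1 : ℝ) else 0) • (unitVec n i - unitVec n j) := by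
  rw [hf.2.2 A]
  split_ifs with hc
  · rw [hc.1]; simp
  · simp

/-- A flip between acyclic orientations gives an edge of the polytope. -/
theorem IsBuildingSet.isExposed_segment (hE : IsBuildingSet n E) {h h' : HyperOrientation E}
    {i j : ℕ} (hf : h.PairFlip h' i j) (hh : h.IsAcyclic) (hh' : h'.IsAcyclic) :
    IsExposed ℝ (hypergraphicPolytope n E) (segment ℝ (inDegreeSeq n h) (inDegreeSeq n h')) := by
  classical
  intro _
  obtain ⟨w, hwij, hw⟩ := hE.exists_weight_of_pairFlip hf hh hh'
  obtain ⟨A₀, hA₀j, hA₀i, -⟩ := hf.exists_flipped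
  have hi : i ∈ Finset.Icc 1 n := hE.subset A₀.1 A₀.2 hA₀i
  have hj : j ∈ Finset.Icc 1 n := hA₀j ▸ hE.head_mem_Icc h A₀
  set l := weightFunctional n w
  have hlw : ∀ {v : ℕ}, v ∈ Finset.Icc 1 n → l (unitVec n v) = w v :=
    fun hv => weightFunctional_unitVec w hv
  have hlij : l (unitVec n i) = l (unitVec n j) := by rw [hlw hi, hlw hj, hwij]
  have hlt : ∀ A : {A : Finset ℕ // A ∈ E}, ∀ u ∈ A.1, u ≠ h.head A →
      ¬ (h.head A = j ∧ u = i) → l (unitVec n u) < l (unitVec n (h.head A)) := by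
    intro A u hu hne hc
    rw [hlw (hE.subset A.1 A.2 hu), hlw (hE.head_mem_Icc h A)]
    exact hw A u hu hne hc
  have hmax : ∀ A : {A : Finset ℕ // A ∈ E}, ∀ u ∈ A.1,
      l (unitVec n u) ≤ l (unitVec n (h.head A)) := by
    intro A u hu
    by_cases hne : u = h.head A
    · rw [hne]
    by_cases hc : h.head A = j ∧ u = i
    · rw [hc.1, hc.2, hlij]
    · exact (hlt A u hu hne hc).le
  -- The indicator of the flipped hyperedges; the sum of its values is the number of heads that move
  -- from `j` to `i`.
  let c (A : {A : Finset ℕ // A ∈ E}) : ℝ := if h.head A = j ∧ i ∈ A.1 then 1 else 0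
  have hsum' : inDegreeSeq n h' =
      inDegreeSeq n h + (∑ A, c A) • (unitVec n i - unitVec n j) := by
    rw [inDegreeSeq_eq_sum, inDegreeSeq_eq_sum, Finset.sum_smul, ← Finset.sum_add_distrib]
    exact Finset.sum_congr rfl fun A _ => hf.unitVec_head A
  have hl' : l (inDegreeSeq n h') = l (inDegreeSeq n h) := by
    rw [hsum', map_add, map_smul, map_sub, hlij, sub_self, smul_zero, add_zero]
  have hseg : ∀ z ∈ segment ℝ (inDegreeSeq n h) (inDegreeSeq n h'),
      l z = l (inDegreeSeq n h) := by
    rintro z ⟨s, t, -, -, hst, rfl⟩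
    rw [map_add, map_smul, map_smul, hl', ← add_smul, hst, one_smul]
  refine ⟨l, Set.Subset.antisymm ?_ ?_⟩
  · intro z hz
    refine ⟨convex_hypergraphicPolytope.segment_subset (hE.inDegreeSeq_mem h)
      (hE.inDegreeSeq_mem h') hz, fun y hy => ?_⟩
    rw [hseg z hz]
    exact apply_le_apply_inDegreeSeq hmax hy
  · rintro z ⟨hz, hzmax⟩
    obtain ⟨g, hg, rfl⟩ := mem_hypergraphicPolytope.mp hz
    have hle := hzmax _ (hE.inDegreeSeq_mem h)
    have hgl := apply_eq_of_maximal hmax hg hle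
    have hsupp : ∀ (A : {A : Finset ℕ // A ∈ E}) (k : {i : ℕ // i ∈ Finset.Icc 1 n}),
        k.1 ≠ h.head A → ¬ (h.head A = j ∧ k.1 = i) → g A k = 0 := fun A k h₁ h₂ =>
      eq_zero_of_mem_simplex (hmax A) (hg A) (hgl A) k fun hk => hlt A k.1 hk h₁ h₂
    have hnonneg : ∀ A, 0 ≤ g A ⟨i, hi⟩ := fun A => (simplex_subset A.1 (hg A)).1 _
    have hleone : ∀ A, g A ⟨i, hi⟩ ≤ 1 := by
      intro A
      rw [← (simplex_subset A.1 (hg A)).2.1]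
      exact Finset.single_le_sum (f := fun k => g A k)
        (fun k _ => (simplex_subset A.1 (hg A)).1 k) (Finset.mem_univ _)
    -- Ties occur only between `i` and `j` in flipped hyperedges, so each summand of a maximizer is
    -- the unit vector of its head, moved towards `i` in the flipped case.
    have hgA : ∀ A, g A = unitVec n (h.head A) +
        (c A * g A ⟨i, hi⟩) • (unitVec n i - unitVec n j) := by
      intro A
      by_cases hc : h.head A = j ∧ i ∈ A.1
      · have := eq_unitVec_add_of_mem_simplex (hg A) (i := ⟨i, hi⟩) (j := ⟨j, hj⟩)
          (fun he => hf.1 (congrArg Subtype.val he)) fun k hki hkj =>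
            hsupp A k (by rw [hc.1]; exact fun he => hkj (Subtype.ext he))
              fun he => hki (Subtype.ext he.2)
        simpa [c, hc] using this
      · have := eq_unitVec_of_mem_simplex (hg A) (hE.head_mem_Icc h A) fun k hk => by
          by_cases hkA : k.1 ∈ A.1
          · exact hsupp A k hk fun hc' => hc ⟨hc'.1, hc'.2 ▸ hkA⟩
          · exact (simplex_subset A.1 (hg A)).2.2 k hkA
        rw [this]
        simp [c, hc]
    have hc₀ : ∀ A, 0 ≤ c A := fun A => by
      simp only [c]; split_ifs <;> norm_num
    have hCpos : 0 < ∑ A, c A :=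
      Finset.sum_pos' (fun A _ => hc₀ A) ⟨A₀, Finset.mem_univ _, by simp [c, hA₀j, hA₀i]⟩
    have hT : ∑ A, g A = inDegreeSeq n h +
        (∑ A, c A * g A ⟨i, hi⟩) • (unitVec n i - unitVec n j) := by
      rw [inDegreeSeq_eq_sum, Finset.sum_smul, ← Finset.sum_add_distrib]
      exact Finset.sum_congr rfl fun A _ => hgA A
    rw [segment_eq_image']
    -- The parameter on the segment is the average `i`-coordinate over the flipped hyperedges.
    refine ⟨(∑ A, c A * g A ⟨i, hi⟩) / ∑ A, c A, ⟨?_, ?_⟩, ?_⟩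
    · exact div_nonneg (Finset.sum_nonneg fun A _ => mul_nonneg (hc₀ A) (hnonneg A)) hCpos.le
    · rw [div_le_one hCpos]
      exact Finset.sum_le_sum fun A _ => mul_le_of_le_one_right (hc₀ A) (hleone A)
    · change inDegreeSeq n h + _ • (inDegreeSeq n h' - inDegreeSeq n h) = _
      rw [hT, hsum', add_sub_cancel_left, smul_smul, div_mul_cancel₀ _ hCpos.ne']

/-- Changing one head within the vertices of maximal weight stays on an exposed segment. -/
theorem IsBuildingSet.exists_smul_of_segment (hE : IsBuildingSet n E) {h : HyperOrientation E}
    {y : Space n} {l : Space n →L[ℝ] ℝ}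
    (hseg : segment ℝ (inDegreeSeq n h) y =
      {z ∈ hypergraphicPolytope n E | ∀ y ∈ hypergraphicPolytope n E, l y ≤ l z})
    {A : {A : Finset ℕ // A ∈ E}} {u : ℕ} (hu : u ∈ A.1) :
    l (unitVec n u) ≤ l (unitVec n (h.head A)) ∧
      (l (unitVec n u) = l (unitVec n (h.head A)) → ∃ t : ℝ, 0 ≤ t ∧
        unitVec n u - unitVec n (h.head A) = t • (y - inDegreeSeq n h)) := by
  have hmem : inDegreeSeq n h ∈ {z ∈ hypergraphicPolytope n E |
      ∀ y ∈ hypergraphicPolytope n E, l y ≤ l z} := hseg ▸ left_mem_segment ℝ _ _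
  have hle := hmem.2 _ (hE.inDegreeSeq_mem (updateHead h A hu))
  refine ⟨?_, fun he => ?_⟩
  · rw [inDegreeSeq_updateHead, map_add, map_sub] at hle
    linarith
  · have : inDegreeSeq n (updateHead h A hu) ∈ segment ℝ (inDegreeSeq n h) y := by
      rw [hseg]
      refine ⟨hE.inDegreeSeq_mem _, fun y hy => (hmem.2 y hy).trans (le_of_eq ?_)⟩
      rw [inDegreeSeq_updateHead, map_add, map_sub, he, sub_self, add_zero]
    rw [segment_eq_image'] at this
    obtain ⟨t, ⟨ht, -⟩, hz⟩ := this
    refine ⟨t, ht, ?_⟩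
    rw [inDegreeSeq_updateHead] at hz
    exact (add_left_cancel hz).symm

/-- Edges of the polytope come from flips. -/
theorem IsBuildingSet.exists_pairFlip (hE : IsBuildingSet n E) {h h' : HyperOrientation E}
    (hne : h ≠ h') (hexp : IsExposed ℝ (hypergraphicPolytope n E)
      (segment ℝ (inDegreeSeq n h) (inDegreeSeq n h'))) : ∃ i j, h.PairFlip h' i j := by
  obtain ⟨l, hseg⟩ := hexp ⟨_, left_mem_segment ℝ _ _⟩
  have hseg' := hseg
  rw [segment_symm] at hseg'
  have key := fun {A} {u} => hE.exists_smul_of_segment hseg (A := A) (u := u)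
  have key' := fun {A} {u} => hE.exists_smul_of_segment hseg' (A := A) (u := u)
  have heq : ∀ A, l (unitVec n (h'.head A)) = l (unitVec n (h.head A)) := fun A =>
    le_antisymm (key (h'.head_mem A)).1 (key' (h.head_mem A)).1
  -- One hyperedge with different heads fixes the direction of the segment: it is parallel to
  -- $e_i-e_j$, with positive factor `t₀`.
  obtain ⟨A₀, hA₀⟩ : ∃ A, h.head A ≠ h'.head A := by
    by_contra! hcon
    exact hne (HyperOrientation.ext (funext hcon))
  obtain ⟨t₀, ht₀, hd⟩ := (key (h'.head_mem A₀)).2 (heq A₀)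
  have hi := hE.head_mem_Icc h' A₀
  generalize hi' : h'.head A₀ = i at *
  generalize hj' : h.head A₀ = j at *
  have hij : i ≠ j := hA₀.symm
  have ht₀ : 0 < t₀ := by
    refine lt_of_le_of_ne ht₀ ?_
    rintro rfl
    rw [zero_smul, sub_eq_zero] at hd
    exact hij (unitVec_injOn hi hd)
  have hmul : ∀ {t : ℝ} {v : Space n}, v = t • (inDegreeSeq n h' - inDegreeSeq n h) →
      t₀ • v = t • (unitVec n i - unitVec n j) := by
    rintro t v rfl
    rw [hd, smul_comm]
  have hlij : l (unitVec n i) = l (unitVec n j) := by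
    have := heq A₀
    rwa [hi', hj'] at this
  refine ⟨i, j, hij, hne.symm, fun A => ?_⟩
  split_ifs with hc
  -- Moving the head of `A` in `h'` to `i` stays in the face and starts at the other end of the
  -- segment, so the displacement is a nonnegative multiple of $e_j-e_i$. Yet its `i`-coordinate is
  -- 1.
  · by_contra hA
    obtain ⟨t, ht, hz⟩ := (key' hc.2).2 (by rw [heq A, hc.1, hlij])
    have hz' := congrFun (hmul (t := -t) (hz.trans (by rw [neg_smul, ← smul_neg, neg_sub])))
      ⟨i, hi⟩
    simp only [Pi.smul_apply, Pi.sub_apply, unitVec_apply, if_neg (Ne.symm hA), if_neg hij,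
      if_true, smul_eq_mul] at hz'
    linarith
  -- A changed head gives a difference of two unit vectors proportional to $e_i-e_j$ with
  -- nonnegative factor; comparing coordinates, the head moves from `j` to `i`, so that `A` contains
  -- `i` after all.
  · by_contra hA
    obtain ⟨t, ht, hz⟩ := (key (h'.head_mem A)).2 (heq A)
    have hz' := hmul hz
    have h₁ := congrFun hz' ⟨_, hE.head_mem_Icc h' A⟩
    have h₂ := congrFun hz' ⟨_, hE.head_mem_Icc h A⟩
    simp only [Pi.smul_apply, Pi.sub_apply, unitVec_apply, if_true, if_neg hA,
      if_neg (Ne.symm hA), smul_eq_mul] at h₁ h₂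
    have hui : h'.head A = i := by
      by_contra hui
      rw [if_neg hui] at h₁
      split_ifs at h₁ <;> linarith
    have hvj : h.head A = j := by
      by_contra hvj
      rw [if_neg hvj] at h₂
      split_ifs at h₂ <;> linarith
    exact hc ⟨hvj, hui ▸ h'.head_mem A⟩

/-- The in-degree sequence as a map to the vertices of the polytope. -/
noncomputable def IsBuildingSet.vertexEquiv (hE : IsBuildingSet n E) :
    AO E ≃ {x : Space n // x ∈ (hypergraphicPolytope n E).exposedPoints ℝ} :=
  Equiv.ofBijective (fun h => ⟨inDegreeSeq n h.1, hE.inDegreeSeq_mem_exposedPoints h.2⟩)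
    ⟨fun h _ he => Subtype.ext (hE.inDegreeSeq_injective h.2 (congrArg Subtype.val he)),
      fun x => (hE.exists_of_mem_exposedPoints x.2).imp fun _ => Subtype.ext⟩

/-- The flip graph is isomorphic to the skeleton of the hypergraphic polytope. -/
noncomputable def IsBuildingSet.flipGraphIso (hE : IsBuildingSet n E) :
    flipGraph E ≃g skeleton (hypergraphicPolytope n E) where
  toEquiv := hE.vertexEquiv
  map_rel_iff' {h h'} := by
    constructor
    · rintro ⟨hne, hexp⟩
      obtain ⟨i, j, hf⟩ := hE.exists_pairFlip (h := h.1) (h' := h'.1)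
        (fun he => hne (congrArg _ (Subtype.ext he))) hexp
      exact flipGraph_adj_of_pairFlip hf
    · intro hadj
      refine ⟨fun he => hadj.ne (hE.vertexEquiv.injective he), ?_⟩
      rw [flipGraph, SimpleGraph.fromRel_adj] at hadj
      obtain ⟨-, ⟨i, j, hf⟩ | ⟨i, j, hf⟩⟩ := hadj
      · exact hE.isExposed_segment hf h.2 h'.2
      · rw [segment_symm]
        exact hE.isExposed_segment hf h'.2 h.2

/-! ### The Hamilton path -/

theorem exists_map_eq {α β : Type*} (f : α → β) (l : List β) (hl : ∀ b ∈ l, ∃ a, b = f a) :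
    ∃ l' : List α, l'.map f = l := by
  induction l with
  | nil => exact ⟨[], rfl⟩
  | cons b l ih =>
    obtain ⟨a, rfl⟩ := hl b (by simp)
    obtain ⟨l', rfl⟩ := ih fun b hb => hl b (by simp [hb])
    exact ⟨a :: l', rfl⟩

/-- By injectivity of `perm`, the run lifts from permutations to acyclic orientations: neighbours in
the list are flips, no orientation repeats, and none is missed. -/
theorem IsChordalBuildingSet.exists_hamiltonian (hE : IsChordalBuildingSet n E) :
    ∃ (h₁ h₂ : AO E) (p : (flipGraph E).Walk h₁ h₂), p.IsHamiltonian ∧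
      AlgorithmJ (permLanguage n E) (idPerm n) (p.support.map fun h => perm n h.1) := by
  obtain ⟨hid, out, hrun⟩ := hE.exists_isGrayRun
  obtain ⟨l, rfl⟩ := exists_map_eq (fun h : AO E => perm n h.1) out fun π hπ =>
    (hrun.mem_iff π).mp hπ
  have hne : l ≠ [] := by
    rintro rfl
    exact hrun.history.ne_nil rfl
  have hchain : l.IsChain (flipGraph E).Adj := by
    have := hrun.history.isChain
    rw [List.isChain_map] at this
    refine this.imp fun h h' => ?_
    rintro ⟨g, g', hadj, he, he'⟩
    rwa [hE.perm_injective he, hE.perm_injective he']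
  have hnodup : l.Nodup := hrun.history.nodup.of_map _
  refine ⟨_, _, SimpleGraph.Walk.ofSupport l hne hchain, fun h => ?_, ?_⟩
  · rw [SimpleGraph.Walk.support_ofSupport]
    refine List.count_eq_one_of_mem hnodup ?_
    obtain ⟨h', hh', he⟩ := List.mem_map.mp ((hrun.mem_iff (perm n h.1)).mpr ⟨h, rfl⟩)
    rwa [← hE.perm_injective he]
  · rw [SimpleGraph.Walk.support_ofSupport]
    exact hrun.algorithmJ

end

end HypergraphGray

theorem mainTheorem3 (n : ℕ) (E : Finset (Finset ℕ))
    (hE : HypergraphGray.IsChordalBuildingSet n E) :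
    ∃ φ : HypergraphGray.flipGraph E ≃g
        HypergraphGray.skeleton (HypergraphGray.hypergraphicPolytope n E),
      (∀ h : HypergraphGray.AO E, (φ h).1 = HypergraphGray.inDegreeSeq n h.1) ∧
      ∃ (h₁ h₂ : HypergraphGray.AO E) (p : (HypergraphGray.flipGraph E).Walk h₁ h₂),
        (∀ out : List (List ℕ),
          HypergraphGray.AlgorithmJ (HypergraphGray.permLanguage n E)
              (HypergraphGray.idPerm n) out ↔
            out = p.support.map (fun h => HypergraphGray.perm n h.1)) ∧
        p.IsHamiltonian ∧
        (p.map φ.toHom).IsHamiltonian := by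
  obtain ⟨h₁, h₂, p, hp, hJ⟩ := hE.exists_hamiltonian
  exact ⟨hE.flipGraphIso, fun _ => rfl, h₁, h₂, p, hJ.iff_eq List.nodup_range', hp,
    hp.map _ hE.flipGraphIso.bijective⟩
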